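/- Let $k\ge 1$, and for $N\in\mathbb N$ let $\mathcal A_{1/N}=M_k(\mathbb C)^{\otimes N}$ with its operator norm. Let $S_N$ be the symmetrizer on $\mathcal A_{1/N}$, i.e. the linear map with $S_N(A_1\otimes\cdots\otimes A_N)=\frac1{N!}\sum_{\pi}A_{\pi(1)}\otimes\cdots\otimes A_{\pi(N)}$, and for $N\ge M$ put $S_{M,N}(A)=S_N(A\otimes I^{\otimes(N-M)})$, $A\in\mathcal A_{1/M}$. Let $\mathcal A_0$ be the quasi-local algebra: sequences $(A_N)_N$, $A_N\in\mathcal A_{1/N}$, such that for every $\varepsilon>0$ there are $M$ and $A\in\mathcal A_{1/M}$ with $\|A_N-A\otimes I^{\otimes (N-M)}\|<\varepsilon$ for all large $N$, modulo sequences with $\|A_N\|\to0$. For a state $\omega$ on $\mathcal A_0$ let $\omega_{|N}$ be its restriction along $\mathcal A_{1/N}\ni A\mapsto[A\otimes I^{\otimes(N'-N)}]_{N'}\in\mathcal A_0$, and $\rho^\omega_{|N}$ the density matrix of $\omega_{|N}$; $\omega$ is permutation-invariant if $\omega_{|N}\circ S_N=\omega_{|N}$ for all $N$. Write $S^\pi(\mathcal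 A_0)$ for the set of permutation-invariant states, and $X=S(M_k(\mathbb C))$ for the state space of $M_k(\mathbb C)$; all state spaces carry the weak-$*$ topology. For $\rho\in X$ let $\rho^{\otimes\infty}$ denote the product state $\rho^{\otimes\infty}([A_N]_N)=\lim_N\rho^{\otimes N}(A_N)$. A sequence $H=(H_{1/N})_N$, $H_{1/N}\in\mathcal A_{1/N}$, is quasi-symmetric if $S_N(H_{1/N})=H_{1/N}$ for all $N$ and for every $\varepsilon>0$ there are $M_0$, $M$ and $A\in\mathcal A_{1/M}$ such that $\|H_{1/N}-S_{M,N}(A)\|<\varepsilon$ for all $N>M_0$ with $N\ge M$; put $\tilde H_{1/N}=NH_{1/N}$. **Proposition.** Every $\omega\in S^\pi(\mathcal A_0)$ has the form $\omega=\int_X\rho^{\otimes\infty}\,d\mu_\omega(\rho)$ (weakly) for a unique Borel probability measure $\mu_\omega$ on $X$, and $\omega\mapsto\big(f\mapsto\omega(f):=\int_X f\,d\mu_\omega\big)$ is an affine homeomorphism from $S^\pi(\mathcal A_0)$ onto $S(C(X))$. The function $s_0(\rho)=-\mathrm{Tr}(\rho\log\rho)$ (with $\rho$ identified with its density matrix)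 is continuous on $X$, and for every quasi-symmetric sequence $H$ the limit $h_0(\rho)=\lim_{N\to\infty}\rho^{\otimes N}(H_{1/N})$ exists for all $\rho\in X$ and defines $h_0\in C(X)$. For every $\omega\in S^\pi(\mathcal A_0)$, every quasi-symmetric $H$ and every $\beta>0$ the following limits exist and have the stated values: $$U(\tilde H,\omega)=\lim_{N\to\infty}\tfrac1N\,\omega_{|N}(\tilde H_{1/N})=\omega(h_0),$$ $$S(\omega)=\lim_{N\to\infty}-\tfrac1N\mathrm{Tr}\big(\rho^\omega_{|N}\log\rho^\omega_{|N}\big)=\omega(s_0),$$ $$F^\beta(\tilde H,\omega)=\lim_{N\to\infty}\tfrac1N\Big(\omega_{|N}(\tilde H_{1/N})+\tfrac1\beta\mathrm{Tr}\big(\rho^\omega_{|N}\log\rho^\omega_{|N}\big)\Big)=\omega(h_0)-\beta^{-1}\omega(s_0).$$ Under the above identification $S^\pi(\mathcal A_0)\cong S(C(X))$ these limits define weak-$*$ continuous affine functionals $U(\tilde H,\cdot)$, $S$ and $F^\beta(\tilde H,\cdot)$ on $S(C(X))$. -/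

import Mathlib

open Filter Topology MeasureTheory

noncomputable section

namespace MeanField

open scoped ComplexOrder

/-! ### States of a unital complex star-algebra -/

/-- A state on a unital complex `*`-algebra: a linear functional which is positive (nonnegative on
all elements `a* a`) and normalised. In a C*-algebra the positive elements are exactly the `a* a`,
and positive functionals are automatically bounded, so on C*-algebras this is the usual notion. -/
structure State (A : Type*) [Ring A] [StarRing A] [Algebra ℂ A] where
  toLin : A →ₗ[ℂ] ℂ
  nonneg' : ∀ a : A, 0 ≤ toLin (star a * a)
  map_one' : toLin 1 = 1

namespace State

variable {A : Type*} [Ring A] [StarRing A] [Algebra ℂ A]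

instance : CoeFun (State A) (fun _ => A → ℂ) := ⟨fun φ => φ.toLin⟩

/-- The weak-* topology: the topology of pointwise convergence on the algebra. -/
instance : TopologicalSpace (State A) :=
  TopologicalSpace.induced (fun (φ : State A) (a : A) => φ a) inferInstance

/-- The Borel sigma-algebra of the weak-* topology. -/
instance : MeasurableSpace (State A) := borel (State A)

instance : BorelSpace (State A) := ⟨rfl⟩

/-- `φ = t φ₁ + (1 - t) φ₂` with `t ∈ [0, 1]`. -/
def IsConvexComb (t : ℝ) (φ₁ φ₂ φ : State A) : Prop :=
  0 ≤ t ∧ t ≤ 1 ∧ φ.toLin = (t : ℂ) • φ₁.toLin + ((1 - t : ℝ) : ℂ) • φ₂.toLin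

/-- A functional on the convex set of states (with values in a real vector space) is affine. -/
def IsAffine {V : Type*} [AddCommGroup V] [Module ℝ V] (F : State A → V) : Prop :=
  ∀ (t : ℝ) (φ₁ φ₂ φ : State A), IsConvexComb t φ₁ φ₂ φ → F φ = t • F φ₁ + (1 - t) • F φ₂

lemma map_star [StarModule ℂ A] (φ : State A) (a : A) : φ (star a) = star (φ a) := by
  have e : ∀ b : A, (φ b + φ (star b)).im = 0 := by
    intro b
    have h := (Complex.nonneg_iff.1 (φ.nonneg' (1 + b))).2
    have h1 := (Complex.nonneg_iff.1 (φ.nonneg' b)).2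
    have h2 : star (1 + b) * (1 + b) = 1 + (b + star b) + star b * b := by
      rw [star_add, star_one]; noncomm_ring
    rw [h2, map_add, map_add, map_add, φ.map_one', Complex.add_im, ← h1] at h
    simpa using h.symm
  have h1 := e a
  have h2 := e (Complex.I • a)
  rw [star_smul, map_smul, map_smul] at h2
  apply Complex.ext
  · simp at h2 ⊢
    linarith
  · simp at h1 ⊢
    linarith

end State

lemma State.norm_apply_le {A : Type*} [CStarAlgebra A] [PartialOrder A] [StarOrderedRing A]
    (φ : State A) (a : A) : ‖φ a‖ ≤ ‖a‖ := by
  have h1 : φ (star a * a) ≤ ((‖a‖ ^ 2 : ℝ) : ℂ) := by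
    obtain ⟨b, hb⟩ := CStarAlgebra.nonneg_iff_eq_star_mul_self.1
      (sub_nonneg.2 (CStarAlgebra.star_mul_le_algebraMap_norm_sq (a := a)))
    have := φ.nonneg' b
    rw [← hb, map_sub, sub_nonneg, IsScalarTower.algebraMap_apply ℝ ℂ A,
      Algebra.algebraMap_eq_smul_one, map_smul, φ.map_one'] at this
    simpa using this
  have h2 : ((‖φ a‖ ^ 2 : ℝ) : ℂ) ≤ φ (star a * a) := by
    have := φ.nonneg' (a - φ a • 1)
    have e : star (a - φ a • 1) * (a - φ a • 1)
        = star a * a - φ a • star a - star (φ a) • a + (star (φ a) * φ a) • (1 : A) := by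
      simp only [star_sub, star_smul, star_one, sub_mul, mul_sub, smul_mul_assoc, mul_smul_comm,
        one_mul, mul_one, smul_sub, smul_smul]
      rw [mul_comm (star (φ a)) (φ a)]
      abel
    rw [e, map_add, map_sub, map_sub, map_smul, map_smul, map_smul, φ.map_one', map_star] at this
    have e2 : ((‖φ a‖ ^ 2 : ℝ) : ℂ) = star (φ a) * φ a := by
      rw [Complex.ofReal_pow]; exact (Complex.conj_mul' (φ a)).symm
    rw [e2, ← sub_nonneg]
    convert this using 1
    simp only [smul_eq_mul]
    ring
  have h3 : ‖φ a‖ ^ 2 ≤ ‖a‖ ^ 2 := by exact_mod_cast h2.trans h1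
  exact le_of_sq_le_sq h3 (norm_nonneg a)

/-! ### Finite systems -/

/-- The algebra `M_k(ℂ)^{⊗N}`, realised as the operators on `(ℂ^k)^{⊗N}`: matrices indexed by the
product basis `(Fin k)^N`. -/
abbrev SpinAlg (k N : ℕ) : Type := Matrix (Fin N → Fin k) (Fin N → Fin k) ℂ

/-- The elementary tensor `A₁ ⊗ ⋯ ⊗ A_N`. -/
def tensor {k N : ℕ} (A : Fin N → Matrix (Fin k) (Fin k) ℂ) : SpinAlg k N :=
  Matrix.of fun σ τ => ∏ i, A i (σ i) (τ i)

/-- A configuration of `N` sites, split into its first `M` sites and the remaining ones. -/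
def splitEquiv (k : ℕ) {M N : ℕ} (h : M ≤ N) :
    (Fin N → Fin k) ≃ (Fin M → Fin k) × ({i : Fin N // ¬ (i : ℕ) < M} → Fin k) :=
  (Equiv.piEquivPiSubtypeProd (fun i : Fin N => (i : ℕ) < M) (fun _ => Fin k)).trans
    (Equiv.prodCongr
      (Equiv.arrowCongr
        { toFun := fun i => (⟨i.1, i.2⟩ : Fin M)
          invFun := fun j => ⟨Fin.castLE h j, j.2⟩
          left_inv := fun _ => rfl
          right_inv := fun _ => rfl } (Equiv.refl _))
      (Equiv.refl _))

open scoped Kronecker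

/-- The embedding `A ↦ A ⊗ I ⊗ ⋯ ⊗ I` of `M` sites into `N ≥ M` sites, a unital
`*`-homomorphism. -/
def embed {k M N : ℕ} (h : M ≤ N) : SpinAlg k M →⋆ₐ[ℂ] SpinAlg k N where
  toFun A := (A ⊗ₖ (1 : Matrix ({i : Fin N // ¬ (i : ℕ) < M} → Fin k) _ ℂ)).submatrix
    (splitEquiv k h) (splitEquiv k h)
  map_one' := by simp
  map_mul' A B := by
    rw [Matrix.submatrix_mul_equiv, ← Matrix.mul_kronecker_mul, one_mul]
  map_zero' := by simp
  map_add' A B := by rw [Matrix.add_kronecker]; rfl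
  commutes' c := by
    rw [Algebra.algebraMap_eq_smul_one, Algebra.algebraMap_eq_smul_one, Matrix.smul_kronecker]
    rw [Matrix.one_kronecker_one]
    ext σ τ
    simp [Matrix.one_apply]
  map_star' A := by
    simp only [Matrix.star_eq_conjTranspose, Matrix.conjTranspose_submatrix,
      Matrix.conjTranspose_kronecker, Matrix.conjTranspose_one]

lemma embed_apply {k M N : ℕ} (h : M ≤ N) (A : SpinAlg k M) (σ τ : Fin N → Fin k) :
    embed h A σ τ = A (fun i => σ (Fin.castLE h i)) (fun i => τ (Fin.castLE h i)) *
      if ∀ i : Fin N, ¬ (i : ℕ) < M → σ i = τ i then 1 else 0 := by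
  change A _ _ * (1 : Matrix ({i : Fin N // ¬ (i : ℕ) < M} → Fin k) _ ℂ) _ _ = _
  rw [Matrix.one_apply]
  congr 1
  refine if_congr ?_ rfl rfl
  rw [funext_iff]
  exact ⟨fun H i hi => H ⟨i, hi⟩, fun H i => H i.1 i.2⟩

lemma embed_embed {k L M N : ℕ} (h : L ≤ M) (h' : M ≤ N) (A : SpinAlg k L) :
    embed h' (embed h A) = embed (h.trans h') A := by
  ext σ τ
  rw [embed_apply, embed_apply, embed_apply, mul_assoc]
  congr 1
  rw [ite_zero_mul_ite_zero, one_mul]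
  refine if_congr ?_ rfl rfl
  constructor
  · rintro ⟨H1, H2⟩ i hi
    by_cases hM : (i : ℕ) < M
    · exact H1 ⟨i, hM⟩ hi
    · exact H2 i hM
  · exact fun H => ⟨fun i hi => H (Fin.castLE h' i) hi, fun i hi => H i (by omega)⟩

lemma embed_tensor {k M N : ℕ} (h : M ≤ N) (A : Fin M → Matrix (Fin k) (Fin k) ℂ) :
    embed h (tensor A) = tensor (fun i : Fin N => if hi : (i : ℕ) < M then A ⟨i, hi⟩ else 1) := by
  obtain ⟨L, rfl⟩ := Nat.exists_eq_add_of_le h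
  ext σ τ
  rw [embed_apply]
  simp only [tensor, Matrix.of_apply]
  rw [Fin.prod_univ_add]
  congr 1
  · exact Finset.prod_congr rfl fun i _ => by simp; rfl
  · simp only [Fin.val_natAdd, not_lt.2 (Nat.le_add_right M _), dite_false, Matrix.one_apply,
      Finset.prod_ite_zero, Finset.prod_const_one, Finset.mem_univ, forall_const]
    refine if_congr ⟨fun H i => H _ (by simp), fun H i hi => ?_⟩ rfl rfl
    have := H ⟨i - M, by omega⟩
    rwa [show Fin.natAdd M (⟨i - M, by omega⟩ : Fin L) = i from
      Fin.ext (by simp; omega)] at this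

/-- The symmetrizer `S_N`, the average over all permutations of the tensor factors. -/
def symmetrizer (k N : ℕ) : SpinAlg k N →ₗ[ℂ] SpinAlg k N where
  toFun A := ((N.factorial : ℂ))⁻¹ • ∑ π : Equiv.Perm (Fin N), A.submatrix (· ∘ π) (· ∘ π)
  map_add' A B := by
    rw [← smul_add, ← Finset.sum_add_distrib]; rfl
  map_smul' c A := by
    rw [RingHom.id_apply, smul_comm c, Finset.smul_sum (r := c)]; rfl

lemma symmetrizer_tensor {k N : ℕ} (A : Fin N → Matrix (Fin k) (Fin k) ℂ) :
    symmetrizer k N (tensor A) =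
      ((N.factorial : ℂ))⁻¹ • ∑ π : Equiv.Perm (Fin N), tensor (fun i => A (π i)) := by
  change ((N.factorial : ℂ))⁻¹ • ∑ π : Equiv.Perm (Fin N),
    (tensor A).submatrix (· ∘ π) (· ∘ π) = _
  congr 1
  refine Fintype.sum_equiv (Equiv.inv _) _ _ fun π => ?_
  ext σ τ
  change ∏ i, A i (σ (π i)) (τ (π i)) = ∏ i, A (π⁻¹ i) (σ i) (τ i)
  exact Fintype.prod_equiv π _ _ fun i => by simp

/-- `S_{M,N}(A) = S_N(A ⊗ I ⊗ ⋯ ⊗ I)`. -/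
def symmEmbed {k M N : ℕ} (h : M ≤ N) (A : SpinAlg k M) : SpinAlg k N :=
  symmetrizer k N (embed h A)

/-- The density matrix `D` of a functional `φ` on a matrix algebra: `φ(A) = Tr (D A)`. -/
def density {n : Type*} [Fintype n] [DecidableEq n] (φ : Matrix n n ℂ →ₗ[ℂ] ℂ) : Matrix n n ℂ :=
  Matrix.of fun i j => φ (Matrix.single j i 1)

lemma trace_density_mul {n : Type*} [Fintype n] [DecidableEq n] (φ : Matrix n n ℂ →ₗ[ℂ] ℂ)
    (A : Matrix n n ℂ) : (density φ * A).trace = φ A := by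
  conv_rhs => rw [Matrix.matrix_eq_sum_single A]
  simp only [Matrix.trace, Matrix.diag, Matrix.mul_apply, density, Matrix.of_apply, map_sum]
  rw [Finset.sum_comm]
  refine Finset.sum_congr rfl fun i _ => Finset.sum_congr rfl fun j _ => ?_
  rw [show Matrix.single i j (A i j) = A i j • Matrix.single i j (1 : ℂ) by simp, map_smul,
    smul_eq_mul, mul_comm]

/-- The von Neumann entropy `-Tr (D log D)` of the density matrix `D` of `φ`, where `log D` is
given by functional calculus with `log 0 = 0` (so that `0 log 0 = 0`). -/
def entropy {n : Type*} [Fintype n] [DecidableEq n] (φ : Matrix n n ℂ →ₗ[ℂ] ℂ) : ℝ :=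
  -(density φ * cfc Real.log (density φ)).trace.re

/-! ### The quasi-local algebra -/

open scoped Matrix.Norms.L2Operator

/-- The local sequence `N ↦ A ⊗ I^{N-M}` (for `N ≥ M`) defined by an observable `A` of the first
`M` sites. -/
def localSeq {k M : ℕ} (A : SpinAlg k M) (N : ℕ) : SpinAlg k N :=
  if h : M ≤ N then embed h A else 0

/-- A quasi-local sequence: up to arbitrarily small `ε` in operator norm, it eventually agrees with
a local sequence. -/
def IsQuasiLocal {k : ℕ} (a : ∀ N, SpinAlg k N) : Prop :=
  ∀ ε : ℝ, 0 < ε → ∃ (M : ℕ) (A : SpinAlg k M), ∀ᶠ N in atTop, ‖a N - localSeq A N‖ < ε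

lemma norm_embed_le {k M N : ℕ} (h : M ≤ N) (A : SpinAlg k M) : ‖embed h A‖ ≤ ‖A‖ :=
  NonUnitalStarAlgHom.norm_apply_le (embed h) A

lemma localSeq_of_le {k M N : ℕ} (h : M ≤ N) (A : SpinAlg k M) : localSeq A N = embed h A :=
  dif_pos h

lemma norm_localSeq_le {k M : ℕ} (A : SpinAlg k M) (N : ℕ) : ‖localSeq A N‖ ≤ ‖A‖ := by
  unfold localSeq
  split_ifs with h
  · exact norm_embed_le h A
  · simp

lemma localSeq_embed {k M M' : ℕ} (h : M ≤ M') (A : SpinAlg k M) {N : ℕ} (hN : M' ≤ N) :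
    localSeq (embed h A) N = localSeq A N := by
  rw [localSeq_of_le hN, localSeq_of_le (h.trans hN), embed_embed]

lemma isQuasiLocal_localSeq {k M : ℕ} (A : SpinAlg k M) : IsQuasiLocal (localSeq A) :=
  fun ε hε => ⟨M, A, Eventually.of_forall fun N => by simpa using hε⟩

lemma isQuasiLocal_algebraMap {k : ℕ} (c : ℂ) :
    IsQuasiLocal (algebraMap ℂ (∀ N, SpinAlg k N) c) := fun ε hε =>
  ⟨0, algebraMap ℂ _ c, Eventually.of_forall fun N => by
    rw [localSeq_of_le (Nat.zero_le N), AlgHomClass.commutes]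
    simpa using hε⟩

lemma IsQuasiLocal.add {k : ℕ} {a b : ∀ N, SpinAlg k N} (ha : IsQuasiLocal a)
    (hb : IsQuasiLocal b) : IsQuasiLocal (a + b) := by
  intro ε hε
  obtain ⟨M, A, hA⟩ := ha (ε / 2) (half_pos hε)
  obtain ⟨M', B, hB⟩ := hb (ε / 2) (half_pos hε)
  refine ⟨max M M', embed (le_max_left _ _) A + embed (le_max_right _ _) B, ?_⟩
  filter_upwards [hA, hB, eventually_ge_atTop (max M M')] with N h1 h2 hN
  rw [localSeq_of_le hN, map_add, ← localSeq_of_le hN, ← localSeq_of_le hN, localSeq_embed _ _ hN,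
    localSeq_embed _ _ hN, Pi.add_apply, add_sub_add_comm]
  linarith [norm_add_le (a N - localSeq A N) (b N - localSeq B N)]

lemma IsQuasiLocal.star {k : ℕ} {a : ∀ N, SpinAlg k N} (ha : IsQuasiLocal a) :
    IsQuasiLocal (star a) := by
  intro ε hε
  obtain ⟨M, A, hA⟩ := ha ε hε
  refine ⟨M, Star.star A, ?_⟩
  filter_upwards [hA, eventually_ge_atTop M] with N h1 hN
  rwa [localSeq_of_le hN, map_star, ← localSeq_of_le hN, Pi.star_apply, ← star_sub, norm_star]

lemma IsQuasiLocal.bounded {k : ℕ} {a : ∀ N, SpinAlg k N} (ha : IsQuasiLocal a) :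
    ∃ C : ℝ, 0 < C ∧ ∀ᶠ N in atTop, ‖a N‖ ≤ C := by
  obtain ⟨M, A, hA⟩ := ha 1 one_pos
  refine ⟨‖A‖ + 1, by positivity, ?_⟩
  filter_upwards [hA] with N h1
  have h2 := norm_add_le (a N - localSeq A N) (localSeq A N)
  rw [sub_add_cancel] at h2
  linarith [norm_localSeq_le A N]

lemma IsQuasiLocal.mul {k : ℕ} {a b : ∀ N, SpinAlg k N} (ha : IsQuasiLocal a)
    (hb : IsQuasiLocal b) : IsQuasiLocal (a * b) := by
  intro ε hε
  obtain ⟨C, hC, hbC⟩ := hb.bounded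
  obtain ⟨M, A, hA⟩ := ha (ε / 2 / C) (by positivity)
  obtain ⟨M', B, hB⟩ := hb (ε / 2 / (‖A‖ + 1)) (by positivity)
  refine ⟨max M M', embed (le_max_left _ _) A * embed (le_max_right _ _) B, ?_⟩
  filter_upwards [hA, hB, hbC, eventually_ge_atTop (max M M')] with N h1 h2 h3 hN
  rw [localSeq_of_le hN, map_mul, ← localSeq_of_le hN, ← localSeq_of_le hN, localSeq_embed _ _ hN,
    localSeq_embed _ _ hN, Pi.mul_apply]
  have e : a N * b N - localSeq A N * localSeq B N
      = (a N - localSeq A N) * b N + localSeq A N * (b N - localSeq B N) := by noncomm_ring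
  rw [e]
  have h4 : ‖(a N - localSeq A N) * b N‖ < ε / 2 := by
    calc _ ≤ ‖a N - localSeq A N‖ * ‖b N‖ := norm_mul_le _ _
      _ ≤ ‖a N - localSeq A N‖ * C := by gcongr
      _ < ε / 2 / C * C := by gcongr
      _ = ε / 2 := by field_simp
  have h5 : ‖localSeq A N * (b N - localSeq B N)‖ ≤ ε / 2 := by
    calc _ ≤ ‖localSeq A N‖ * ‖b N - localSeq B N‖ := norm_mul_le _ _
      _ ≤ (‖A‖ + 1) * (ε / 2 / (‖A‖ + 1)) := by
          gcongr
          linarith [norm_localSeq_le A N]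
      _ = ε / 2 := by field_simp
  linarith [norm_add_le ((a N - localSeq A N) * b N) (localSeq A N * (b N - localSeq B N))]

/-- The `*`-algebra of quasi-local sequences. -/
def quasiLocalSeq (k : ℕ) : StarSubalgebra ℂ (∀ N, SpinAlg k N) where
  carrier := {a | IsQuasiLocal a}
  mul_mem' := IsQuasiLocal.mul
  add_mem' := IsQuasiLocal.add
  algebraMap_mem' := isQuasiLocal_algebraMap
  star_mem' := IsQuasiLocal.star

/-- The ideal of quasi-local sequences that are asymptotically zero in norm. -/
def nullIdeal (k : ℕ) : Ideal (quasiLocalSeq k) where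
  carrier := {a | Tendsto (fun N => ‖a.1 N‖) atTop (𝓝 0)}
  zero_mem' := by simp
  add_mem' {a b} ha hb := by
    refine squeeze_zero (fun N => norm_nonneg _) (fun N => norm_add_le (a.1 N) (b.1 N)) ?_
    simpa using Tendsto.add ha hb
  smul_mem' c a ha := by
    obtain ⟨C, hC, h⟩ := IsQuasiLocal.bounded c.2
    refine squeeze_zero' (g := fun N => C * ‖a.1 N‖)
      (Eventually.of_forall fun N => norm_nonneg _) ?_ (by simpa using Tendsto.const_mul C ha)
    filter_upwards [h] with N hN
    exact (norm_mul_le (c.1 N) (a.1 N)).trans (by gcongr)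

instance (k : ℕ) : (nullIdeal k).IsTwoSided where
  mul_mem_of_left {a} b ha := by
    obtain ⟨C, hC, h⟩ := IsQuasiLocal.bounded b.2
    refine squeeze_zero' (g := fun N => ‖a.1 N‖ * C)
      (Eventually.of_forall fun N => norm_nonneg _) ?_ (by simpa using Tendsto.mul_const C ha)
    filter_upwards [h] with N hN
    exact (norm_mul_le (a.1 N) (b.1 N)).trans (by gcongr)

/-- The quasi-local algebra `[M_k(ℂ)]^∞`: quasi-local sequences modulo sequences tending to zero in
norm. Only its `*`-algebra structure is recorded: states and their weak-* topology depend on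
nothing else. -/
abbrev QuasiLocalAlg (k : ℕ) : Type := quasiLocalSeq k ⧸ nullIdeal k

lemma star_mem_nullIdeal {k : ℕ} {a : quasiLocalSeq k} (ha : a ∈ nullIdeal k) :
    star a ∈ nullIdeal k := by
  change Tendsto (fun N => ‖star (a.1 N)‖) atTop (𝓝 0)
  simp only [norm_star]
  exact ha

/-- The involution `[A_N]* = [A_N*]`. -/
instance (k : ℕ) : StarRing (QuasiLocalAlg k) where
  star := Quotient.map' star fun a b h => by
    rw [Submodule.quotientRel_def] at h ⊢
    rw [show star a - star b = star (a - b) from (star_sub a b).symm]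
    exact star_mem_nullIdeal h
  star_involutive x := by
    obtain ⟨a, rfl⟩ := Ideal.Quotient.mk_surjective x
    change Ideal.Quotient.mk _ (star (star a)) = _
    rw [star_star]
  star_mul x y := by
    obtain ⟨a, rfl⟩ := Ideal.Quotient.mk_surjective x
    obtain ⟨b, rfl⟩ := Ideal.Quotient.mk_surjective y
    change Ideal.Quotient.mk _ (star (a * b)) = Ideal.Quotient.mk _ (star b * star a)
    rw [star_mul]
  star_add x y := by
    obtain ⟨a, rfl⟩ := Ideal.Quotient.mk_surjective x
    obtain ⟨b, rfl⟩ := Ideal.Quotient.mk_surjective y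
    change Ideal.Quotient.mk _ (star (a + b)) = Ideal.Quotient.mk _ (star a + star b)
    rw [star_add]

instance (k : ℕ) : StarModule ℂ (QuasiLocalAlg k) where
  star_smul c x := by
    obtain ⟨a, rfl⟩ := Ideal.Quotient.mk_surjective x
    change Ideal.Quotient.mk _ (star (c • a)) = Ideal.Quotient.mk _ (star c • star a)
    rw [star_smul]

/-- The class `[A_N]_N` of a quasi-local sequence. -/
def toQuasiLocal {k : ℕ} : quasiLocalSeq k →ₐ[ℂ] QuasiLocalAlg k :=
  Ideal.Quotient.mkₐ ℂ (nullIdeal k)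

/-- The canonical embedding of the observables of `M` sites into the quasi-local algebra,
`A ↦ [A ⊗ I^{N-M}]_N`. -/
def localEmbed (k M : ℕ) : SpinAlg k M →ₗ[ℂ] QuasiLocalAlg k where
  toFun A := toQuasiLocal ⟨localSeq A, isQuasiLocal_localSeq A⟩
  map_add' A B := by
    rw [← map_add]
    congr 1
    ext1
    funext N
    change localSeq (A + B) N = localSeq A N + localSeq B N
    unfold localSeq
    split_ifs <;> simp
  map_smul' c A := by
    rw [← map_smul]
    congr 1
    ext1
    funext N
    change localSeq (c • A) N = c • localSeq A N
    unfold localSeq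
    split_ifs <;> simp

/-- The restriction `ω|_N` of a functional on the quasi-local algebra to `N` sites. -/
def restrict {k : ℕ} (ω : State (QuasiLocalAlg k)) (N : ℕ) : SpinAlg k N →ₗ[ℂ] ℂ :=
  ω.toLin ∘ₗ localEmbed k N

/-- Permutation invariance: every restriction satisfies `ω|_N ∘ S_N = ω|_N`. -/
def IsPermInvariant {k : ℕ} (ω : State (QuasiLocalAlg k)) : Prop :=
  ∀ N, restrict ω N ∘ₗ symmetrizer k N = restrict ω N

/-- The space of permutation-invariant states, with the weak-* topology. -/
abbrev PermInvState (k : ℕ) : Type := {ω : State (QuasiLocalAlg k) // IsPermInvariant ω}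

/-! ### Product states -/

open scoped MatrixOrder

/-- The state space of the one-site algebra `M_k(ℂ)`. -/
abbrev SiteState (k : ℕ) : Type := State (Matrix (Fin k) (Fin k) ℂ)

/-- The functional `ρ^{⊗N}` on `M_k(ℂ)^{⊗N}`. -/
def prodFun {k : ℕ} (ρ : SiteState k) (N : ℕ) : SpinAlg k N →ₗ[ℂ] ℂ where
  toFun A := ∑ σ, ∑ τ, A σ τ * ∏ i, ρ (Matrix.single (σ i) (τ i) 1)
  map_add' A B := by simp [add_mul, Finset.sum_add_distrib]
  map_smul' c A := by simp [Finset.mul_sum, mul_assoc]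

lemma SiteState.apply_eq {k : ℕ} (ρ : SiteState k) (A : Matrix (Fin k) (Fin k) ℂ) :
    ρ A = ∑ i, ∑ j, A i j * ρ (Matrix.single i j 1) := by
  conv_lhs => rw [Matrix.matrix_eq_sum_single A]
  simp only [map_sum]
  refine Finset.sum_congr rfl fun i _ => Finset.sum_congr rfl fun j _ => ?_
  rw [show Matrix.single i j (A i j) = A i j • Matrix.single i j (1 : ℂ) by simp, map_smul,
    smul_eq_mul]

/-- `ρ^{⊗N}(A₁ ⊗ ⋯ ⊗ A_N) = ρ(A₁) ⋯ ρ(A_N)`. -/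
lemma prodFun_tensor {k N : ℕ} (ρ : SiteState k) (A : Fin N → Matrix (Fin k) (Fin k) ℂ) :
    prodFun ρ N (tensor A) = ∏ i, ρ (A i) := by
  rw [Finset.prod_congr rfl fun i _ => SiteState.apply_eq ρ (A i)]
  simp only [Finset.prod_univ_sum, Fintype.piFinset_univ, Finset.prod_mul_distrib]
  rfl

lemma tensor_mul {k N : ℕ} (A B : Fin N → Matrix (Fin k) (Fin k) ℂ) :
    tensor A * tensor B = tensor (fun i => A i * B i) := by
  ext σ τ
  simp only [tensor, Matrix.mul_apply, Matrix.of_apply, Finset.prod_univ_sum,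
    Fintype.piFinset_univ, Finset.prod_mul_distrib]

lemma star_tensor {k N : ℕ} (A : Fin N → Matrix (Fin k) (Fin k) ℂ) :
    star (tensor A) = tensor (fun i => star (A i)) := by
  ext σ τ
  simp [tensor, Matrix.star_apply]

lemma density_posSemidef {k : ℕ} (ρ : SiteState k) : (density ρ.toLin).PosSemidef := by
  have key : ∀ x : Fin k → ℂ, star x ⬝ᵥ (density ρ.toLin).mulVec x
      = ρ (Matrix.vecMulVec x (star x)) := by
    intro x
    rw [SiteState.apply_eq, Finset.sum_comm]
    simp only [dotProduct, Matrix.mulVec, density, Matrix.of_apply, Matrix.vecMulVec_apply,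
      Finset.mul_sum]
    exact Finset.sum_congr rfl fun i _ => Finset.sum_congr rfl fun j _ => by ring
  have pos : ∀ x : Fin k → ℂ, 0 ≤ star x ⬝ᵥ (density ρ.toLin).mulVec x := by
    intro x
    rw [key]
    obtain ⟨B, hB⟩ := CStarAlgebra.nonneg_iff_eq_star_mul_self.1
      (Matrix.nonneg_iff_posSemidef.2 (Matrix.posSemidef_vecMulVec_self_star x))
    rw [hB]
    exact ρ.nonneg' B
  refine Matrix.PosSemidef.of_dotProduct_mulVec_nonneg ?_ pos
  ext i j
  simp only [Matrix.conjTranspose_apply, density, Matrix.of_apply]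
  rw [show star (ρ.toLin (Matrix.single i j 1)) = _ from (State.map_star ρ _).symm]
  simp [Matrix.star_eq_conjTranspose]

lemma prodFun_eq_trace {k : ℕ} (ρ : SiteState k) (N : ℕ) (A : SpinAlg k N) :
    prodFun ρ N A = (tensor (fun _ : Fin N => density ρ.toLin) * A).trace := by
  simp only [Matrix.trace, Matrix.diag, Matrix.mul_apply]
  rw [Finset.sum_comm]
  exact Finset.sum_congr rfl fun σ _ => Finset.sum_congr rfl fun τ _ => mul_comm _ _

/-- The product state `ρ^{⊗N}`. -/
def prodState {k : ℕ} (ρ : SiteState k) (N : ℕ) : State (SpinAlg k N) where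
  toLin := prodFun ρ N
  nonneg' A := by
    obtain ⟨B, hB⟩ := CStarAlgebra.nonneg_iff_eq_star_mul_self.1
      (Matrix.nonneg_iff_posSemidef.2 (density_posSemidef ρ))
    have h : tensor (fun _ : Fin N => density ρ.toLin)
        = star (tensor fun _ => B) * (tensor fun _ => B) := by
      rw [star_tensor, tensor_mul, hB]
    rw [prodFun_eq_trace, h, mul_assoc, Matrix.trace_mul_comm]
    have h2 : tensor (fun _ : Fin N => B) * (star A * A) * star (tensor fun _ => B)
        = (A * (tensor fun _ => B).conjTranspose).conjTranspose
          * (A * (tensor fun _ => B).conjTranspose) := by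
      simp only [Matrix.conjTranspose_mul, Matrix.conjTranspose_conjTranspose,
        Matrix.star_eq_conjTranspose, mul_assoc]
    rw [h2]
    exact (Matrix.posSemidef_conjTranspose_mul_self _).trace_nonneg
  map_one' := by
    have h : (1 : SpinAlg k N) = tensor (fun _ => 1) := by
      ext σ τ
      simp only [tensor, Matrix.one_apply, Matrix.of_apply, Finset.prod_ite_zero,
        Finset.prod_const_one, Finset.mem_univ, forall_const, funext_iff]
    rw [h, prodFun_tensor]
    exact Finset.prod_eq_one fun i _ => ρ.map_one'

lemma prodFun_embed {k M N : ℕ} (ρ : SiteState k) (h : M ≤ N) (A : SpinAlg k M) :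
    prodFun ρ N (embed h A) = prodFun ρ M A := by
  rw [Matrix.matrix_eq_sum_single A]
  simp only [map_sum]
  refine Finset.sum_congr rfl fun σ _ => Finset.sum_congr rfl fun τ _ => ?_
  have e : Matrix.single σ τ (A σ τ)
      = A σ τ • tensor (fun i => Matrix.single (σ i) (τ i) (1 : ℂ)) := by
    ext σ' τ'
    simp only [tensor, Matrix.single_apply, Matrix.smul_apply, Matrix.of_apply,
      Finset.prod_ite_zero, Finset.prod_const_one, smul_eq_mul, mul_ite, mul_one, mul_zero,
      funext_iff, Finset.mem_univ, forall_const, forall_and]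
  rw [e, map_smul, map_smul, map_smul, embed_tensor, prodFun_tensor, prodFun_tensor]
  congr 1
  obtain ⟨L, rfl⟩ := Nat.exists_eq_add_of_le h
  rw [Fin.prod_univ_add]
  simp [ρ.map_one']

lemma exists_prodLim {k : ℕ} (ρ : SiteState k) (a : quasiLocalSeq k) :
    ∃ z : ℂ, Tendsto (fun N => prodState ρ N (a.1 N)) atTop (𝓝 z) := by
  refine cauchySeq_tendsto_of_complete (Metric.cauchySeq_iff'.2 fun ε hε => ?_)
  obtain ⟨M, A, hA⟩ := a.2 (ε / 2) (half_pos hε)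
  obtain ⟨L, hL⟩ := eventually_atTop.1 hA
  have near : ∀ N, max L M ≤ N → dist (prodState ρ N (a.1 N)) (prodFun ρ M A) < ε / 2 := by
    intro N hN
    have h1 := hL N ((le_max_left _ _).trans hN)
    rw [localSeq_of_le ((le_max_right _ _).trans hN)] at h1
    rw [← prodFun_embed ρ ((le_max_right _ _).trans hN) A, dist_eq_norm]
    refine lt_of_le_of_lt ?_ h1
    rw [show prodState ρ N (a.1 N) - prodFun ρ N (embed ((le_max_right _ _).trans hN) A)
      = prodState ρ N (a.1 N - embed ((le_max_right _ _).trans hN) A) from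
      ((prodState ρ N).toLin.map_sub _ _).symm]
    exact State.norm_apply_le _ _
  refine ⟨max L M, fun N hN => ?_⟩
  have h1 := near N hN
  have h2 := near (max L M) le_rfl
  rw [dist_comm] at h2
  linarith [dist_triangle (prodState ρ N (a.1 N)) (prodFun ρ M A)
    (prodState ρ (max L M) (a.1 (max L M)))]

/-- The limit `lim_N ρ^{⊗N}(A_N)` along a quasi-local sequence. -/
def prodLim {k : ℕ} (ρ : SiteState k) (a : quasiLocalSeq k) : ℂ := (exists_prodLim ρ a).choose

lemma tendsto_prodLim {k : ℕ} (ρ : SiteState k) (a : quasiLocalSeq k) :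
    Tendsto (fun N => prodState ρ N (a.1 N)) atTop (𝓝 (prodLim ρ a)) :=
  (exists_prodLim ρ a).choose_spec

lemma prodLim_congr {k : ℕ} (ρ : SiteState k) {a b : quasiLocalSeq k} (h : a - b ∈ nullIdeal k) :
    prodLim ρ a = prodLim ρ b := by
  have h0 : Tendsto (fun N => prodState ρ N (a.1 N) - prodState ρ N (b.1 N)) atTop (𝓝 0) := by
    refine squeeze_zero_norm (fun N => ?_) h
    rw [show prodState ρ N (a.1 N) - prodState ρ N (b.1 N) = prodState ρ N (a.1 N - b.1 N) from
      ((prodState ρ N).toLin.map_sub _ _).symm]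
    exact State.norm_apply_le _ _
  exact sub_eq_zero.1 (tendsto_nhds_unique
    ((tendsto_prodLim ρ a).sub (tendsto_prodLim ρ b)) h0)

/-- The infinite product state `ρ^{⊗∞}` on the quasi-local algebra:
`ρ^{⊗∞}([A_N]_N) = lim_N ρ^{⊗N}(A_N)`. -/
def infProdState {k : ℕ} (ρ : SiteState k) : State (QuasiLocalAlg k) where
  toLin :=
    { toFun := fun x => Quotient.liftOn' x (prodLim ρ) fun a b h =>
        prodLim_congr ρ ((Submodule.quotientRel_def _).1 h)
      map_add' := fun x y => by
        obtain ⟨a, rfl⟩ := Ideal.Quotient.mk_surjective x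
        obtain ⟨b, rfl⟩ := Ideal.Quotient.mk_surjective y
        change prodLim ρ (a + b) = prodLim ρ a + prodLim ρ b
        refine tendsto_nhds_unique (tendsto_prodLim ρ (a + b))
          (((tendsto_prodLim ρ a).add (tendsto_prodLim ρ b)).congr fun N => ?_)
        exact ((prodState ρ N).toLin.map_add _ _).symm
      map_smul' := fun c x => by
        obtain ⟨a, rfl⟩ := Ideal.Quotient.mk_surjective x
        change prodLim ρ (c • a) = c * prodLim ρ a
        refine tendsto_nhds_unique (tendsto_prodLim ρ (c • a))
          (((tendsto_prodLim ρ a).const_mul c).congr fun N => ?_)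
        exact ((prodState ρ N).toLin.map_smul _ _).symm }
  nonneg' x := by
    obtain ⟨a, rfl⟩ := Ideal.Quotient.mk_surjective x
    change 0 ≤ prodLim ρ (star a * a)
    exact ge_of_tendsto' (tendsto_prodLim ρ (star a * a)) fun N =>
      (prodState ρ N).nonneg' (a.1 N)
  map_one' := by
    change prodLim ρ 1 = 1
    refine tendsto_nhds_unique (tendsto_prodLim ρ 1) ?_
    refine tendsto_const_nhds.congr fun N => ?_
    exact (prodState ρ N).map_one'.symm

lemma infProdState_localEmbed {k : ℕ} (ρ : SiteState k) (M : ℕ) (A : SpinAlg k M) :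
    infProdState ρ (localEmbed k M A) = prodState ρ M A := by
  refine tendsto_nhds_unique (tendsto_prodLim ρ ⟨localSeq A, isQuasiLocal_localSeq A⟩)
    (tendsto_const_nhds.congr' ?_)
  filter_upwards [eventually_ge_atTop M] with N hN
  change prodFun ρ M A = prodFun ρ N (localSeq A N)
  rw [localSeq_of_le hN, prodFun_embed]

/-- `μ` represents `ω` as a mixture of product states: `ω = ∫ ρ^{⊗∞} dμ(ρ)`, the integral being
understood weakly, that is, after evaluation on each element of the quasi-local algebra. -/
def IsDeFinettiMeasure {k : ℕ} (ω : State (QuasiLocalAlg k))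
    (μ : ProbabilityMeasure (SiteState k)) : Prop :=
  ∀ a : QuasiLocalAlg k,
    Integrable (fun ρ : SiteState k => infProdState ρ a) (μ : Measure (SiteState k)) ∧
      ω a = ∫ ρ, infProdState ρ a ∂(μ : Measure (SiteState k))

/-! ### Quasi-symmetric sequences and thermodynamic quantities -/

/-- A symmetric sequence: `A_N = S_{M,N}(A)` for all `N ≥ M`, for some `M` and some observable `A`
of `M` sites. -/
def IsSymmetricSeq {k : ℕ} (H : ∀ N, SpinAlg k N) : Prop :=
  ∃ (M : ℕ) (A : SpinAlg k M), ∀ (N : ℕ) (h : M ≤ N), H N = symmEmbed h A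

/-- A quasi-symmetric sequence: invariant under the symmetrizers, and uniformly approximated in
operator norm by symmetric sequences for large `N`. -/
def IsQuasiSymmetricSeq {k : ℕ} (H : ∀ N, SpinAlg k N) : Prop :=
  (∀ N, H N = symmetrizer k N (H N)) ∧
    ∀ ε : ℝ, 0 < ε → ∃ H' : ∀ N, SpinAlg k N, IsSymmetricSeq H' ∧
      ∃ M : ℕ, ∀ N, M < N → ‖H N - H' N‖ < ε

/-- The local internal energy `U_N(A, ω_N) = ω_N(A)`. -/
def localEnergy {k N : ℕ} (A : SpinAlg k N) (ω : SpinAlg k N →ₗ[ℂ] ℂ) : ℂ := ω A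

/-- The local free energy `F_N^β(A, ω_N) = U_N(A, ω_N) - β⁻¹ S_N(ω_N)`. -/
def localFreeEnergy {k N : ℕ} (β : ℝ) (A : SpinAlg k N) (ω : SpinAlg k N →ₗ[ℂ] ℂ) : ℂ :=
  localEnergy A ω - (β : ℂ)⁻¹ * (entropy ω : ℂ)

/-- The Hamiltonian `N H_N` associated with a sequence `H`. -/
def hamiltonian {k : ℕ} (H : ∀ N, SpinAlg k N) (N : ℕ) : SpinAlg k N := (N : ℂ) • H N

end MeanField

end

noncomputable section

namespace MeanField

open scoped ComplexOrder Kronecker Matrix.Norms.L2Operator MatrixOrder CompactlySupported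

/-! ### The topology of state spaces -/

namespace State

variable {A : Type*} [Ring A] [StarRing A] [Algebra ℂ A]

/-! Write X for the one-site state space. The central map sends a state φ of C(X) to the mixture A ↦
φ(ρ ↦ ρ^{⊗N}(A)); everything is transported along it.

Bijectivity. The functions ρ ↦ ρ^{⊗N}(A) include all products of one-site evaluations, so
Stone–Weierstrass gives injectivity. For surjectivity, a permutation-invariant state is regarded as
a compatible family of symmetric states of finite systems; such families form a compact convex set.
If b*b + c*c = 1 at an additional site, a family is the weighted average of its two conditionings on
b*b and c*c, which are again symmetric families. In an extreme family conditioning therefore changes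
nothing, the additional site factors off, and the family is a product
(`eq_prodFun_of_mem_extremePoints`). The image of the states of C(X) is compact, convex and contains
the product families, so Krein–Milman shows that it contains every family
(`exists_state_of_isSymmFamily`). A continuous bijection from a compact space to a Hausdorff space
is a homeomorphism, and Riesz representation turns states of C(X) into measures.

Energy. The symbol ρ ↦ ρ^{⊗N}(A) ignores symmetrization and added identities, so the symbols of a
quasi-symmetric sequence are uniformly Cauchy, and a state of C(X) is norm continuous.

Entropy. Both bounds come from Klein's inequality S(ψ) ≤ -ψ(log T). Taking for T a faithful
approximation of the mixture and for ψ the product states, then averaging, gives N φ(s₀) ≤ S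
(`mul_apply_siteEntropy_le`). Conversely, for T the uniform average of σ^{⊗N} over a finite set of
faithful σ, operator monotonicity of the logarithm gives S ≤ N(φ(s₀) + ε) + C with C independent of
N (`exists_entropy_marginal_le`). Division by N closes the gap. -/

lemma ext_apply {φ ψ : State A} (h : ∀ a, φ a = ψ a) : φ = ψ := by
  cases φ; cases ψ
  congr 1
  exact LinearMap.ext h

lemma isEmbedding_coe : IsEmbedding (fun (φ : State A) (a : A) => φ a) :=
  ⟨⟨rfl⟩, fun _ _ h => ext_apply (congrFun h)⟩

instance : T2Space (State A) := isEmbedding_coe.t2Space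

lemma continuous_eval (a : A) : Continuous fun φ : State A => φ a :=
  (continuous_apply a).comp isEmbedding_coe.continuous

lemma continuous_of_eval {X : Type*} [TopologicalSpace X] {F : X → State A}
    (h : ∀ a, Continuous fun x => F x a) : Continuous F :=
  isEmbedding_coe.continuous_iff.2 (continuous_pi h)

/-- A state space on which every evaluation is bounded is weak-* compact. -/
lemma compactSpace_of_bound (C : A → ℝ) (hC : ∀ (φ : State A) a, ‖φ a‖ ≤ C a) :
    CompactSpace (State A) := by
  -- Banach–Alaoglu by hand: the states form a subset of the product of copies of ℂ cut out by
  -- closed pointwise conditions, and the bounds put it inside a product of closed discs, compact by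
  -- Tychonoff.
  have hcl : IsClosed {f : A → ℂ | (∀ a b, f (a + b) = f a + f b) ∧
      (∀ (c : ℂ) a, f (c • a) = c * f a) ∧ (∀ a, 0 ≤ f (star a * a)) ∧ f 1 = 1} := by
    simp only [Set.ofPred_and, Set.ofPred_forall]
    refine IsClosed.inter ?_ (IsClosed.inter ?_ (IsClosed.inter ?_ ?_))
    · exact isClosed_iInter fun a => isClosed_iInter fun b =>
        isClosed_eq (by fun_prop) (by fun_prop)
    · exact isClosed_iInter fun a => isClosed_iInter fun b =>
        isClosed_eq (continuous_apply _) (continuous_const.mul (continuous_apply _))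
    · exact isClosed_iInter fun a => isClosed_le continuous_const (continuous_apply _)
    · exact isClosed_eq (continuous_apply _) continuous_const
  have hr : Set.range (fun (φ : State A) (a : A) => φ a) = {f : A → ℂ |
      (∀ a b, f (a + b) = f a + f b) ∧
      (∀ (c : ℂ) a, f (c • a) = c * f a) ∧ (∀ a, 0 ≤ f (star a * a)) ∧ f 1 = 1} := by
    ext f
    constructor
    · rintro ⟨φ, rfl⟩
      exact ⟨φ.toLin.map_add, φ.toLin.map_smul, φ.nonneg', φ.map_one'⟩
    · rintro ⟨h1, h2, h3, h4⟩
      exact ⟨⟨⟨⟨f, h1⟩, h2⟩, h3, h4⟩, rfl⟩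
  have hK : IsCompact (Set.univ.pi fun a : A => Metric.closedBall (0 : ℂ) (C a)) :=
    isCompact_univ_pi fun a => isCompact_closedBall _ _
  have : IsCompact (Set.range (fun (φ : State A) (a : A) => φ a)) := by
    refine hK.of_isClosed_subset (hr ▸ hcl) ?_
    rintro _ ⟨φ, rfl⟩ a -
    simpa using hC φ a
  rw [← isCompact_univ_iff, isEmbedding_coe.isCompact_iff, Set.image_univ]
  exact this

/-- Nonnegativity of the variance, φ((a - φ(a))* (a - φ(a))) ≥ 0, gives |φ(a)|² ≤ φ(a* a). No norm
on the algebra enters, which is what the quasi-local quotient requires. -/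
lemma norm_apply_le_of_apply_star_mul_self_le [StarModule ℂ A] (φ : State A) (a : A) {c : ℝ}
    (hc : 0 ≤ c) (h1 : φ (star a * a) ≤ ((c ^ 2 : ℝ) : ℂ)) : ‖φ a‖ ≤ c := by
  have h2 : ((‖φ a‖ ^ 2 : ℝ) : ℂ) ≤ φ (star a * a) := by
    have := φ.nonneg' (a - φ a • 1)
    have e : star (a - φ a • 1) * (a - φ a • 1)
        = star a * a - φ a • star a - star (φ a) • a + (star (φ a) * φ a) • (1 : A) := by
      simp only [star_sub, star_smul, star_one, sub_mul, mul_sub, smul_mul_assoc, mul_smul_comm,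
        one_mul, mul_one, smul_sub, smul_smul]
      rw [mul_comm (star (φ a)) (φ a)]
      abel
    rw [e, map_add, map_sub, map_sub, map_smul, map_smul, map_smul, φ.map_one', map_star] at this
    have e2 : ((‖φ a‖ ^ 2 : ℝ) : ℂ) = star (φ a) * φ a := by
      rw [Complex.ofReal_pow]; exact (Complex.conj_mul' (φ a)).symm
    rw [e2, ← sub_nonneg]
    convert this using 1
    simp only [smul_eq_mul]
    ring
  have h3 : ‖φ a‖ ^ 2 ≤ c ^ 2 := by exact_mod_cast h2.trans h1
  exact le_of_sq_le_sq h3 hc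

/-- The convex combination `t φ + (1 - t) ψ`. -/
def mix (t : ℝ) (h0 : 0 ≤ t) (h1 : t ≤ 1) (φ ψ : State A) : State A where
  toLin := (t : ℂ) • φ.toLin + ((1 - t : ℝ) : ℂ) • ψ.toLin
  nonneg' a := by
    have h0' : (0 : ℂ) ≤ t := by exact_mod_cast h0
    have h1' : (0 : ℂ) ≤ ((1 - t : ℝ) : ℂ) := by exact_mod_cast sub_nonneg.2 h1
    exact add_nonneg (mul_nonneg h0' (φ.nonneg' a)) (mul_nonneg h1' (ψ.nonneg' a))
  map_one' := by
    simp [φ.map_one', ψ.map_one']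

lemma mix_apply (t : ℝ) (h0 : 0 ≤ t) (h1 : t ≤ 1) (φ ψ : State A) (a : A) :
    mix t h0 h1 φ ψ a = t * φ a + ((1 - t : ℝ) : ℂ) * ψ a := rfl

lemma IsConvexComb.apply {t : ℝ} {φ₁ φ₂ φ : State A} (h : IsConvexComb t φ₁ φ₂ φ) (a : A) :
    φ a = t * φ₁ a + ((1 - t : ℝ) : ℂ) * φ₂ a := by
  rw [h.2.2]; rfl

lemma isAffine_eval (a : A) : IsAffine fun φ : State A => φ a := by
  intro t φ₁ φ₂ φ h
  simp only [h.apply, Complex.real_smul]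

end State

/-! ### States on matrix algebras and on `C(X)` -/

section Matrix

variable {n : Type*} [Fintype n] [DecidableEq n]

instance : CompactSpace (State (Matrix n n ℂ)) :=
  State.compactSpace_of_bound (fun a => ‖a‖) State.norm_apply_le

lemma continuous_density : Continuous fun φ : State (Matrix n n ℂ) => density φ.toLin :=
  continuous_matrix fun _ _ => State.continuous_eval _

/-- A continuous injection from a compact space into a Hausdorff space is a closed embedding. The
resulting metrizability of the state space is what later lets integrals of continuous functions
determine a Borel measure. -/
lemma isClosedEmbedding_density :
    IsClosedEmbedding fun φ : State (Matrix n n ℂ) => density φ.toLin :=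
  continuous_density.isClosedEmbedding fun φ ψ h => State.ext_apply fun a => by
    rw [← trace_density_mul φ.toLin, ← trace_density_mul ψ.toLin]
    exact congrArg (fun D => (D * a).trace) h

instance : TopologicalSpace.MetrizableSpace (State (Matrix n n ℂ)) :=
  (isClosedEmbedding_density (n := n)).isEmbedding.metrizableSpace

end Matrix

section ContinuousFunctions

variable {X : Type*} [TopologicalSpace X]

/-- A continuous function with nonnegative values is of the form `g* g`. -/
lemma exists_star_mul_self_eq {f : C(X, ℂ)} (hf : ∀ x, 0 ≤ f x) :
    ∃ g : C(X, ℂ), f = star g * g := by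
  refine ⟨⟨fun x => ((Real.sqrt (f x).re : ℝ) : ℂ), by fun_prop⟩, ?_⟩
  ext x
  have h := Complex.nonneg_iff.1 (hf x)
  apply Complex.ext <;> simp [← h.2, Real.mul_self_sqrt h.1]

namespace State

lemma apply_nonneg (φ : State C(X, ℂ)) {f : C(X, ℂ)} (hf : ∀ x, 0 ≤ f x) : 0 ≤ φ f := by
  obtain ⟨g, rfl⟩ := exists_star_mul_self_eq hf
  exact φ.nonneg' g

variable [CompactSpace X]

lemma norm_apply_le_norm (φ : State C(X, ℂ)) (f : C(X, ℂ)) : ‖φ f‖ ≤ ‖f‖ := by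
  refine φ.norm_apply_le_of_apply_star_mul_self_le f (norm_nonneg f) ?_
  -- Pointwise |f|² ≤ ‖f‖², so ‖f‖² - f* f is a nonnegative function.
  have h := φ.apply_nonneg (f := ((‖f‖ ^ 2 : ℝ) : ℂ) • 1 - star f * f) fun x => by
    have h1 : ‖f x‖ ^ 2 ≤ ‖f‖ ^ 2 := by gcongr; exact f.norm_coe_le_norm x
    have h2 : star (f x) * f x = ((‖f x‖ ^ 2 : ℝ) : ℂ) := by
      rw [Complex.ofReal_pow]; exact Complex.conj_mul' (f x)
    change 0 ≤ ((‖f‖ ^ 2 : ℝ) : ℂ) * 1 - star (f x) * f x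
    rw [h2, mul_one, sub_nonneg]
    exact_mod_cast h1
  rw [map_sub, map_smul, φ.map_one', sub_nonneg] at h
  simpa using h

lemma apply_im_eq_zero (φ : State C(X, ℂ)) {f : C(X, ℂ)} (hf : ∀ x, (f x).im = 0) :
    (φ f).im = 0 := by
  have h : star f = f := by
    ext x
    apply Complex.ext <;> simp [hf x]
  have h2 := φ.map_star f
  rw [h] at h2
  exact Complex.conj_eq_iff_im.1 h2.symm

/-- States are Hermitian, so they commute with taking real parts; positivity is applied to twice the
real part of `g - f`. The entropy bounds, proved pointwise in ρ, are averaged in this form. -/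
lemma re_apply_le_re_apply (φ : State C(X, ℂ)) {f g : C(X, ℂ)}
    (h : ∀ x, (f x).re ≤ (g x).re) : (φ f).re ≤ (φ g).re := by
  have h1 := φ.apply_nonneg (f := (g - f) + star (g - f)) fun x => by
    rw [Complex.nonneg_iff]
    simp only [ContinuousMap.add_apply, ContinuousMap.star_apply, ContinuousMap.sub_apply]
    constructor
    · have := h x
      simp
      linarith
    · simp
  rw [map_add, map_star] at h1
  have h2 := (Complex.nonneg_iff.1 h1).1
  rw [map_sub] at h2
  simp at h2
  linarith

lemma continuous_coe (φ : State C(X, ℂ)) : Continuous fun f : C(X, ℂ) => φ f :=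
  (φ.toLin.mkContinuous 1 fun f => by simpa using φ.norm_apply_le_norm f).continuous

instance : CompactSpace (State C(X, ℂ)) := compactSpace_of_bound (fun f => ‖f‖) norm_apply_le_norm

/-- The state of `C(X)` given by evaluation at a point. -/
def dirac (x : X) : State C(X, ℂ) where
  toLin := { toFun := fun f => f x, map_add' := fun _ _ => rfl, map_smul' := fun _ _ => rfl }
  nonneg' f := star_mul_self_nonneg (f x)
  map_one' := rfl

/-- States of `C(X)` which agree on a point-separating star-closed set together with its products
are equal. -/
lemma ext_of_separatesPoints {φ ψ : State C(X, ℂ)} (s : Set C(X, ℂ)) (hstar : star s = s)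
    (hs : ∀ x y, x ≠ y → ∃ f ∈ s, f x ≠ f y) (h : ∀ f ∈ Submonoid.closure s, φ f = ψ f) :
    φ = ψ := by
  -- Stone–Weierstrass: the star-subalgebra generated by `s` is dense, and states are norm
  -- continuous.
  have hd := ContinuousMap.starSubalgebra_topologicalClosure_eq_top_of_separatesPoints
    (StarAlgebra.adjoin ℂ s) (by
      intro x y hxy
      obtain ⟨f, hf, hne⟩ := hs x y hxy
      exact ⟨f, ⟨f, StarAlgebra.subset_adjoin ℂ s hf, rfl⟩, hne⟩)
  -- Since `s` is closed under the star, the generated star-algebra is the linear span of the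
  -- products of elements of `s`.
  have h1 : ∀ f ∈ StarAlgebra.adjoin ℂ s, φ f = ψ f := by
    intro f hf
    rw [← StarSubalgebra.mem_toSubalgebra, StarAlgebra.adjoin_toSubalgebra, hstar, Set.union_self,
      ← Subalgebra.mem_toSubmodule, Algebra.adjoin_eq_span] at hf
    exact LinearMap.eqOn_span (f := φ.toLin) (g := ψ.toLin) (fun f hf => h f hf) hf
  refine ext_apply fun f => ?_
  have h2 : f ∈ closure (StarAlgebra.adjoin ℂ s : Set C(X, ℂ)) := by
    rw [← StarSubalgebra.topologicalClosure_coe, hd]; trivial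
  exact closure_minimal h1 (isClosed_eq φ.continuous_coe ψ.continuous_coe) h2

end State

end ContinuousFunctions

/-! ### Observables as functions on the one-site state space -/

/-- The function `ρ ↦ ρ^{⊗N}(A)` on the one-site state space. -/
def prodEval (k N : ℕ) : SpinAlg k N →ₗ[ℂ] C(SiteState k, ℂ) where
  toFun A := ⟨fun ρ => prodFun ρ N A, continuous_finsetSum _ fun σ _ =>
    continuous_finsetSum _ fun τ _ => continuous_const.mul
      (continuous_finsetProd _ fun i _ => State.continuous_eval _)⟩
  map_add' A B := by ext ρ; exact (prodFun ρ N).map_add A B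
  map_smul' c A := by ext ρ; exact (prodFun ρ N).map_smul c A

@[simp] lemma prodEval_apply {k N : ℕ} (A : SpinAlg k N) (ρ : SiteState k) :
    prodEval k N A ρ = prodFun ρ N A := rfl

lemma prodEval_tensor {k N : ℕ} (A : Fin N → Matrix (Fin k) (Fin k) ℂ) (ρ : SiteState k) :
    prodEval k N (tensor A) ρ = ∏ i, ρ (A i) := prodFun_tensor ρ A

lemma norm_prodEval_le {k N : ℕ} (A : SpinAlg k N) : ‖prodEval k N A‖ ≤ ‖A‖ :=
  (ContinuousMap.norm_le _ (norm_nonneg A)).2 fun ρ => (prodState ρ N).norm_apply_le A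

lemma prodEval_embed {k M N : ℕ} (h : M ≤ N) (A : SpinAlg k M) :
    prodEval k N (embed h A) = prodEval k M A := by
  ext ρ; exact prodFun_embed ρ h A

lemma prodEval_one {k N : ℕ} : prodEval k N 1 = 1 := by
  ext ρ; exact (prodState ρ N).map_one'

lemma prodEval_nonneg {k N : ℕ} (A : SpinAlg k N) (ρ : SiteState k) :
    0 ≤ prodEval k N (star A * A) ρ := (prodState ρ N).nonneg' A

lemma single_eq_tensor {k N : ℕ} (σ τ : Fin N → Fin k) (c : ℂ) :
    (Matrix.single σ τ c : SpinAlg k N) =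
      c • tensor (fun i => Matrix.single (σ i) (τ i) (1 : ℂ)) := by
  ext σ' τ'
  simp only [tensor, Matrix.single_apply, Matrix.smul_apply, Matrix.of_apply,
    Finset.prod_ite_zero, Finset.prod_const_one, smul_eq_mul, mul_ite, mul_one, mul_zero,
    funext_iff, Finset.mem_univ, forall_const, forall_and]

/-- Linear maps which agree on elementary tensors are equal. -/
lemma linearMap_ext_tensor {k N : ℕ} {V : Type*} [AddCommGroup V] [Module ℂ V]
    {f g : SpinAlg k N →ₗ[ℂ] V} (h : ∀ A, f (tensor A) = g (tensor A)) : f = g := by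
  ext1 A
  rw [Matrix.matrix_eq_sum_single A]
  simp only [map_sum, single_eq_tensor, map_smul, h]

lemma tensor_submatrix {k N : ℕ} (π : Equiv.Perm (Fin N))
    (A : Fin N → Matrix (Fin k) (Fin k) ℂ) :
    (tensor A).submatrix (· ∘ π) (· ∘ π) = tensor (fun i => A (π⁻¹ i)) := by
  ext σ τ
  change ∏ i, A i (σ (π i)) (τ (π i)) = ∏ i, A (π⁻¹ i) (σ i) (τ i)
  exact Fintype.prod_equiv π _ _ fun i => by simp

/-- Permutation of the tensor factors as a linear map. -/
def permute {k N : ℕ} (π : Equiv.Perm (Fin N)) : SpinAlg k N →ₗ[ℂ] SpinAlg k N where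
  toFun A := A.submatrix (· ∘ π) (· ∘ π)
  map_add' _ _ := rfl
  map_smul' _ _ := rfl

lemma permute_tensor {k N : ℕ} (π : Equiv.Perm (Fin N))
    (A : Fin N → Matrix (Fin k) (Fin k) ℂ) :
    permute π (tensor A) = tensor (fun i => A (π⁻¹ i)) := tensor_submatrix π A

lemma symmetrizer_apply {k N : ℕ} (A : SpinAlg k N) :
    symmetrizer k N A = ((N.factorial : ℂ))⁻¹ • ∑ π : Equiv.Perm (Fin N), permute π A := rfl

lemma symmetrizer_permute {k N : ℕ} (π : Equiv.Perm (Fin N)) (A : SpinAlg k N) :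
    symmetrizer k N (permute π A) = symmetrizer k N A := by
  rw [symmetrizer_apply, symmetrizer_apply]
  congr 1
  exact Fintype.sum_equiv (Equiv.mulRight π) _ _ fun π' => rfl

lemma prodEval_permute {k N : ℕ} (π : Equiv.Perm (Fin N)) (A : SpinAlg k N) :
    prodEval k N (permute π A) = prodEval k N A := by
  refine LinearMap.congr_fun (f := prodEval k N ∘ₗ permute π) (g := prodEval k N)
    (linearMap_ext_tensor fun A => ?_) A
  ext ρ
  rw [LinearMap.comp_apply, permute_tensor, prodEval_tensor, prodEval_tensor]
  exact Fintype.prod_equiv π⁻¹ _ _ fun i => rfl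

lemma prodEval_symmetrizer {k N : ℕ} (A : SpinAlg k N) :
    prodEval k N (symmetrizer k N A) = prodEval k N A := by
  rw [symmetrizer_apply, map_smul, map_sum]
  simp only [prodEval_permute, Finset.sum_const, Finset.card_univ, Fintype.card_perm,
    Fintype.card_fin, ← Nat.cast_smul_eq_nsmul ℂ, smul_smul]
  rw [inv_mul_cancel₀ (by exact_mod_cast N.factorial_ne_zero), one_smul]

/-- A state of `C(S(M_k(ℂ)))` is determined by its values on the functions `ρ ↦ ρ^{⊗N}(A)`. -/
lemma state_ext_prodEval {k : ℕ} {φ ψ : State C(SiteState k, ℂ)}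
    (h : ∀ (N : ℕ) (A : SpinAlg k N), φ (prodEval k N A) = ψ (prodEval k N A)) : φ = ψ := by
  let e : Matrix (Fin k) (Fin k) ℂ → C(SiteState k, ℂ) :=
    fun a => ⟨fun ρ => ρ a, State.continuous_eval a⟩
  have he : ∀ a, star (e a) = e (star a) := fun a => by
    ext ρ; exact (ρ.map_star a).symm
  refine State.ext_of_separatesPoints (Set.range e) ?_ ?_ ?_
  · ext f
    rw [Set.mem_star]
    constructor
    · rintro ⟨a, ha⟩
      exact ⟨star a, by rw [← he, ha, star_star]⟩
    · rintro ⟨a, rfl⟩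
      exact ⟨star a, (he a).symm⟩
  · intro ρ σ hne
    by_contra! hcon
    exact hne (State.ext_apply fun a => hcon (e a) ⟨a, rfl⟩)
  · intro f hf
    obtain ⟨l, hl, rfl⟩ := Submonoid.exists_list_of_mem_closure hf
    choose! g hg using hl
    -- A product of evaluations ρ(a₁)⋯ρ(aₙ) is the value of ρ^{⊗n} on a₁ ⊗ ⋯ ⊗ aₙ, so the hypothesis
    -- covers all products of generators.
    have : l.prod = prodEval k l.length (tensor fun i => g l[i]) := by
      ext ρ
      rw [prodEval_tensor, ← List.prod_ofFn]
      have h1 : ∀ l : List C(SiteState k, ℂ), l.prod ρ = (l.map fun f => f ρ).prod := fun l => by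
        induction l with
        | nil => rfl
        | cons f l ih =>
          rw [List.prod_cons, List.map_cons, List.prod_cons, ← ih, ContinuousMap.mul_apply]
      rw [h1]
      congr 1
      refine List.ext_getElem (by simp) fun i h1 h2 => ?_
      simp only [List.getElem_map, List.getElem_ofFn]
      have := hg (l[i]'(by simpa using h1)) (List.getElem_mem _)
      exact congrArg (fun f : C(SiteState k, ℂ) => f ρ) this.symm
    rw [this, h]

/-! ### States on the quasi-local algebra -/

/-- Continuous functional calculus preserves quasi-locality. -/
lemma IsQuasiLocal.cfc {k : ℕ} {y : ∀ N, SpinAlg k N} (hy : IsQuasiLocal y)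
    (hsa : ∀ᶠ N in atTop, IsSelfAdjoint (y N)) {f : ℝ → ℝ} (hf : Continuous f) :
    IsQuasiLocal fun N => cfc f (y N) := by
  intro ε hε
  obtain ⟨R, hR, hyR⟩ := hy.bounded
  -- Weierstrass approximation on an interval containing all spectra for large `N`. Polynomials
  -- preserve quasi-locality because quasi-local sequences form an algebra; the coefficients are
  -- made complex to stay in that ℂ-algebra.
  obtain ⟨p, hp⟩ := exists_polynomial_near_of_continuousOn (-R) R f hf.continuousOn (ε / 2)
    (half_pos hε)
  let q := Polynomial.aeval (⟨y, hy⟩ : quasiLocalSeq k) (p.map (algebraMap ℝ ℂ))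
  have hq : ∀ N, q.1 N = Polynomial.aeval (y N) p := fun N => by
    rw [← Polynomial.aeval_map_algebraMap ℂ]
    exact (Polynomial.aeval_algHom_apply
      ((Pi.evalAlgHom ℂ (SpinAlg k) N).comp (quasiLocalSeq k).toSubalgebra.val)
      (⟨y, hy⟩ : quasiLocalSeq k) (p.map (algebraMap ℝ ℂ))).symm
  obtain ⟨M, A, hA⟩ := q.2 (ε / 2) (half_pos hε)
  refine ⟨M, A, ?_⟩
  filter_upwards [hA, hyR, hsa] with N h1 h2 h3
  have h4 : ‖_root_.cfc f (y N) - q.1 N‖ ≤ ε / 2 := by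
    rw [hq, ← cfc_polynomial p (y N), ← cfc_sub f p.eval (y N)]
    refine norm_cfc_le (half_pos hε).le fun x hx => ?_
    -- The bound of the spectrum by the norm needs ‖1‖ = 1, which fails in the zero algebra; there
    -- the spectrum is empty.
    rcases subsingleton_or_nontrivial (SpinAlg k N) with hs | hs
    · simp [spectrum.of_subsingleton] at hx
    have : NormOneClass (SpinAlg k N) := ⟨CStarRing.norm_one⟩
    have hx' : ‖x‖ ≤ R := (spectrum.norm_le_norm_of_mem hx).trans h2
    rw [norm_sub_rev]
    exact (hp x (abs_le.1 hx')).le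
  have h5 := norm_add_le (_root_.cfc f (y N) - q.1 N) (q.1 N - localSeq A N)
  rw [sub_add_sub_cancel] at h5
  linarith

lemma toQuasiLocal_eq_of_eventuallyEq {k : ℕ} {a b : quasiLocalSeq k}
    (h : ∀ᶠ N in atTop, a.1 N = b.1 N) : toQuasiLocal a = toQuasiLocal b := by
  refine Ideal.Quotient.eq.2 ?_
  change Tendsto (fun N => ‖a.1 N - b.1 N‖) atTop (𝓝 0)
  refine tendsto_const_nhds.congr' ?_
  filter_upwards [h] with N hN
  rw [hN, sub_self, norm_zero]

/-- A state is bounded by the asymptotic operator norm. -/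
lemma norm_apply_toQuasiLocal_le {k : ℕ} (ω : State (QuasiLocalAlg k)) (a : quasiLocalSeq k)
    {C : ℝ} (hC : 0 ≤ C) (h : ∀ᶠ N in atTop, ‖a.1 N‖ ≤ C) : ‖ω (toQuasiLocal a)‖ ≤ C := by
  refine ω.norm_apply_le_of_apply_star_mul_self_le _ hC ?_
  -- Positivity of a state is only known on elements b* b, so C² - a* a must be written in this form
  -- inside the quotient. It is eventually positive, and its square root, taken by functional
  -- calculus at each `N`, is again quasi-local.
  let y : quasiLocalSeq k := ((C ^ 2 : ℝ) : ℂ) • 1 - star a * a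
  have hy : ∀ᶠ N in atTop, 0 ≤ y.1 N := by
    filter_upwards [h] with N hN
    change 0 ≤ ((C ^ 2 : ℝ) : ℂ) • (1 : SpinAlg k N) - star (a.1 N) * a.1 N
    rw [sub_nonneg]
    refine (CStarAlgebra.star_mul_le_algebraMap_norm_sq (a := a.1 N)).trans ?_
    rw [Algebra.algebraMap_eq_smul_one, Complex.coe_smul]
    gcongr
  have hb := IsQuasiLocal.cfc y.2 (hy.mono fun N hN => hN.isSelfAdjoint) Real.continuous_sqrt
  let b : quasiLocalSeq k := ⟨_, hb⟩
  have e : toQuasiLocal (star b * b) = toQuasiLocal y := by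
    refine toQuasiLocal_eq_of_eventuallyEq ?_
    filter_upwards [hy] with N hN
    change star (cfc Real.sqrt (y.1 N)) * cfc Real.sqrt (y.1 N) = y.1 N
    rw [(cfc_predicate Real.sqrt (y.1 N) : IsSelfAdjoint _).star_eq, ← cfc_mul ..]
    conv_rhs => rw [← cfc_id' ℝ (y.1 N)]
    exact cfc_congr fun x hx => Real.mul_self_sqrt (spectrum_nonneg_of_nonneg hN hx)
  have h2 : (0 : ℂ) ≤ ω (toQuasiLocal y) := by
    rw [← e, map_mul]
    exact ω.nonneg' (toQuasiLocal b)
  rw [map_sub, map_sub, map_smul, map_smul, map_one, ω.map_one', sub_nonneg, map_mul] at h2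
  rwa [smul_eq_mul, mul_one] at h2

/-- The approximating local observable serves all states at once. This uniformity makes ρ ↦
ρ^{⊗∞}(x) a uniform limit of continuous functions. -/
lemma exists_restrict_near {k : ℕ} (a : quasiLocalSeq k) {ε : ℝ} (hε : 0 < ε) :
    ∃ (M : ℕ) (A : SpinAlg k M), ∀ ω : State (QuasiLocalAlg k),
      ‖ω (toQuasiLocal a) - restrict ω M A‖ ≤ ε := by
  obtain ⟨M, A, hA⟩ := a.2 ε hε
  refine ⟨M, A, fun ω => ?_⟩
  let b : quasiLocalSeq k := ⟨localSeq A, isQuasiLocal_localSeq A⟩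
  change ‖ω (toQuasiLocal a) - ω (toQuasiLocal b)‖ ≤ ε
  have h := norm_apply_toQuasiLocal_le ω (a - b) hε.le (hA.mono fun N hN => hN.le)
  rwa [map_sub toQuasiLocal, ω.toLin.map_sub] at h

/-- A state on the quasi-local algebra is determined by its restrictions to finite systems. -/
lemma state_ext_restrict {k : ℕ} {ω ω' : State (QuasiLocalAlg k)}
    (h : ∀ N, restrict ω N = restrict ω' N) : ω = ω' := by
  refine State.ext_apply fun x => ?_
  obtain ⟨a, rfl⟩ := Ideal.Quotient.mk_surjective x
  refine eq_of_forall_dist_le fun ε hε => ?_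
  obtain ⟨M, A, hA⟩ := exists_restrict_near a (half_pos hε)
  have h1 := hA ω
  have h2 := hA ω'
  rw [← dist_eq_norm] at h1 h2
  rw [← h M, dist_comm] at h2
  exact (dist_triangle _ _ _).trans ((add_le_add h1 h2).trans_eq (add_halves ε))

lemma localEmbed_star_mul_self {k M : ℕ} (A : SpinAlg k M) :
    localEmbed k M (star A * A) = star (localEmbed k M A) * localEmbed k M A := by
  refine congrArg toQuasiLocal (a₁ := ⟨localSeq (star A * A), _⟩)
    (a₂ := star ⟨localSeq A, isQuasiLocal_localSeq A⟩ * ⟨localSeq A, isQuasiLocal_localSeq A⟩) ?_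
  ext1
  funext N
  change localSeq (star A * A) N = star (localSeq A N) * localSeq A N
  unfold localSeq
  split_ifs
  · rw [map_mul, map_star]
  · simp

lemma localEmbed_one {k M : ℕ} : localEmbed k M 1 = 1 := by
  rw [← map_one toQuasiLocal]
  refine toQuasiLocal_eq_of_eventuallyEq ?_
  filter_upwards [eventually_ge_atTop M] with N hN
  exact (localSeq_of_le hN 1).trans (map_one _)

lemma localEmbed_embed {k M N : ℕ} (h : M ≤ N) (A : SpinAlg k M) :
    localEmbed k N (embed h A) = localEmbed k M A := by
  refine toQuasiLocal_eq_of_eventuallyEq ?_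
  filter_upwards [eventually_ge_atTop N] with L hL
  exact localSeq_embed h A hL

/-- The function `ρ ↦ ρ^{⊗∞}(x)` on the one-site state space. -/
def quasiEval (k : ℕ) : QuasiLocalAlg k →ₗ[ℂ] C(SiteState k, ℂ) where
  toFun x := ⟨fun ρ => infProdState ρ x, by
    obtain ⟨a, rfl⟩ := Ideal.Quotient.mk_surjective x
    refine continuous_of_uniform_approx_of_continuous fun u hu => ?_
    obtain ⟨ε, hε, hu⟩ := Metric.mem_uniformity_dist.1 hu
    obtain ⟨M, A, hA⟩ := exists_restrict_near a (half_pos hε)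
    refine ⟨prodEval k M A, (prodEval k M A).continuous, fun ρ => hu ?_⟩
    have h := hA (infProdState ρ)
    rw [← dist_eq_norm] at h
    refine lt_of_le_of_lt ?_ (half_lt_self hε)
    rwa [show restrict (infProdState ρ) M A = prodEval k M A ρ from
      infProdState_localEmbed ρ M A] at h⟩
  map_add' x y := by ext ρ; exact (infProdState ρ).toLin.map_add x y
  map_smul' c x := by ext ρ; exact (infProdState ρ).toLin.map_smul c x

lemma quasiEval_localEmbed {k M : ℕ} (A : SpinAlg k M) :
    quasiEval k (localEmbed k M A) = prodEval k M A := by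
  ext ρ; exact infProdState_localEmbed ρ M A

/-- The mixture of product states defined by a state on `C(S(M_k(ℂ)))`. -/
def mixture {k : ℕ} (φ : State C(SiteState k, ℂ)) : State (QuasiLocalAlg k) where
  toLin := φ.toLin ∘ₗ quasiEval k
  nonneg' x := φ.apply_nonneg fun ρ => (infProdState ρ).nonneg' x
  map_one' := by
    rw [LinearMap.comp_apply, show quasiEval k 1 = 1 by ext ρ; exact (infProdState ρ).map_one']
    exact φ.map_one'

lemma mixture_apply {k : ℕ} (φ : State C(SiteState k, ℂ)) (x : QuasiLocalAlg k) :
    mixture φ x = φ (quasiEval k x) := rfl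

lemma restrict_mixture {k : ℕ} (φ : State C(SiteState k, ℂ)) (N : ℕ) :
    restrict (mixture φ) N = φ.toLin ∘ₗ prodEval k N := by
  ext1 A
  change φ (quasiEval k (localEmbed k N A)) = _
  rw [quasiEval_localEmbed]; rfl

lemma isPermInvariant_mixture {k : ℕ} (φ : State C(SiteState k, ℂ)) :
    IsPermInvariant (mixture φ) := by
  intro N
  rw [restrict_mixture]
  ext1 A
  change φ (prodEval k N (symmetrizer k N A)) = φ (prodEval k N A)
  rw [prodEval_symmetrizer]

lemma mixture_injective {k : ℕ} : Function.Injective (mixture (k := k)) := by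
  intro φ ψ h
  refine state_ext_prodEval fun N A => ?_
  have := congrArg (fun ω => restrict ω N A) h
  simp only [restrict_mixture] at this
  exact this

lemma continuous_mixture {k : ℕ} : Continuous (mixture (k := k)) :=
  State.continuous_of_eval fun x => State.continuous_eval (quasiEval k x)

/-! ### Symmetric consistent families of states -/

/-- A configuration of `N + 1` sites, split into the first `N` sites and the last one. -/
def initLastEquiv (k N : ℕ) : (Fin (N + 1) → Fin k) ≃ (Fin N → Fin k) × Fin k where
  toFun σ := (Fin.init σ, σ (Fin.last N))
  invFun p := Fin.snoc (α := fun _ => Fin k) p.1 p.2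
  left_inv σ := Fin.snoc_init_self σ
  right_inv p := by simp

/-- The observable `A ⊗ a` of `N + 1` sites. -/
def append {k N : ℕ} (A : SpinAlg k N) (a : Matrix (Fin k) (Fin k) ℂ) : SpinAlg k (N + 1) :=
  (A ⊗ₖ a).submatrix (initLastEquiv k N) (initLastEquiv k N)

section append

variable {k N : ℕ}

lemma append_apply (A : SpinAlg k N) (a : Matrix (Fin k) (Fin k) ℂ) (σ τ : Fin (N + 1) → Fin k) :
    append A a σ τ = A (Fin.init σ) (Fin.init τ) * a (σ (Fin.last N)) (τ (Fin.last N)) := rfl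

lemma append_mul (A B : SpinAlg k N) (a b : Matrix (Fin k) (Fin k) ℂ) :
    append A a * append B b = append (A * B) (a * b) := by
  rw [append, append, append, Matrix.submatrix_mul_equiv, ← Matrix.mul_kronecker_mul]

lemma star_append (A : SpinAlg k N) (a : Matrix (Fin k) (Fin k) ℂ) :
    star (append A a) = append (star A) (star a) := by
  ext σ τ
  simp [append_apply, Matrix.star_apply]

lemma append_add_left (A B : SpinAlg k N) (a : Matrix (Fin k) (Fin k) ℂ) :
    append (A + B) a = append A a + append B a := by
  ext σ τ; simp [append_apply, add_mul]

lemma append_smul_left (c : ℂ) (A : SpinAlg k N) (a : Matrix (Fin k) (Fin k) ℂ) :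
    append (c • A) a = c • append A a := by
  ext σ τ; simp [append_apply, mul_assoc]

lemma append_add_right (A : SpinAlg k N) (a b : Matrix (Fin k) (Fin k) ℂ) :
    append A (a + b) = append A a + append A b := by
  ext σ τ; simp [append_apply, mul_add]

lemma append_smul_right (c : ℂ) (A : SpinAlg k N) (a : Matrix (Fin k) (Fin k) ℂ) :
    append A (c • a) = c • append A a := by
  ext σ τ; simp [append_apply, mul_left_comm]

lemma append_tensor (A : Fin N → Matrix (Fin k) (Fin k) ℂ) (a : Matrix (Fin k) (Fin k) ℂ) :
    append (tensor A) a
      = tensor (Fin.snoc (α := fun _ => Matrix (Fin k) (Fin k) ℂ) A a) := by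
  ext σ τ
  simp [append_apply, tensor, Fin.prod_univ_castSucc, Fin.init]

lemma append_one (A : SpinAlg k N) : append A 1 = embed N.le_succ A := by
  ext σ τ
  rw [append_apply, embed_apply, Matrix.one_apply]
  congr 1
  refine if_congr ⟨fun h i hi => ?_, fun h => h _ (by simp)⟩ rfl rfl
  rwa [show i = Fin.last N from Fin.ext (by simp; omega)]

lemma tensor_one : tensor (fun _ : Fin N => (1 : Matrix (Fin k) (Fin k) ℂ)) = 1 := by
  ext σ τ
  simp only [tensor, Matrix.one_apply, Matrix.of_apply, Finset.prod_ite_zero,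
    Finset.prod_const_one, Finset.mem_univ, forall_const, funext_iff]

lemma append_one_one : append (1 : SpinAlg k N) 1 = 1 := by
  rw [append_one, map_one]

/-- `A ↦ A ⊗ a` as a linear map. -/
def appendLeft (N : ℕ) (a : Matrix (Fin k) (Fin k) ℂ) : SpinAlg k N →ₗ[ℂ] SpinAlg k (N + 1) where
  toFun A := append A a
  map_add' A B := append_add_left A B a
  map_smul' c A := append_smul_left c A a

end append

/-- A family of states of the finite systems, compatible with the embeddings and invariant under
permutations of the sites. -/
structure IsSymmFamily {k : ℕ} (f : ∀ N, SpinAlg k N → ℂ) : Prop where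
  add : ∀ N A B, f N (A + B) = f N A + f N B
  smul : ∀ N (c : ℂ) A, f N (c • A) = c * f N A
  nonneg : ∀ N A, 0 ≤ f N (star A * A)
  one : ∀ N, f N 1 = 1
  embed : ∀ M N (h : M ≤ N) A, f N (embed h A) = f M A
  perm : ∀ N (π : Equiv.Perm (Fin N)) A, f N (permute π A) = f N A

namespace IsSymmFamily

variable {k : ℕ} {f : ∀ N, SpinAlg k N → ℂ}

/-- The state of `N` sites belonging to the family. -/
def state (hf : IsSymmFamily f) (N : ℕ) : State (SpinAlg k N) where
  toLin := { toFun := f N, map_add' := hf.add N, map_smul' := hf.smul N }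
  nonneg' := hf.nonneg N
  map_one' := hf.one N

/-- The one-site marginal. -/
def site (hf : IsSymmFamily f) : SiteState k where
  toLin :=
    { toFun := fun a => f 1 (append (1 : SpinAlg k 0) a)
      map_add' := fun a b => by rw [append_add_right, hf.add]
      map_smul' := fun c a => by rw [append_smul_right, hf.smul]; rfl }
  nonneg' a := by
    have := hf.nonneg 1 (append 1 a)
    rwa [star_append, append_mul, star_one, one_mul] at this
  map_one' := by
    change f 1 (append 1 1) = 1
    rw [append_one_one]; exact hf.one 1

/-- On elementary tensors the two observables differ only in whether `a` sits at site `N` or at site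
`M`, the sites in between carrying the identity. Invariance under the transposition of these two
sites identifies the values. -/
lemma apply_append_embed (hf : IsSymmFamily f) {M N : ℕ} (h : M ≤ N) (A : SpinAlg k M)
    (a : Matrix (Fin k) (Fin k) ℂ) :
    f (N + 1) (append (MeanField.embed h A) a) = f (M + 1) (append A a) := by
  refine LinearMap.congr_fun
    (f := (hf.state (N + 1)).toLin ∘ₗ appendLeft N a ∘ₗ (MeanField.embed h).toLinearMap)
    (g := (hf.state (M + 1)).toLin ∘ₗ appendLeft M a) (linearMap_ext_tensor fun A => ?_) A
  change f (N + 1) (append (MeanField.embed h (tensor A)) a) = f (M + 1) (append (tensor A) a)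
  rw [embed_tensor, append_tensor, append_tensor, ← hf.embed _ _ (Nat.succ_le_succ h),
    embed_tensor]
  -- The site `M` of the `N + 1` sites exists even if `M = N`; the transposition is then trivial.
  rw [← hf.perm _ (Equiv.swap (Fin.last N) ⟨M, by omega⟩), permute_tensor]
  congr 2
  funext i
  rw [Equiv.swap_inv]
  by_cases hi : (i : ℕ) = M
  · have hM : M < N + 1 := by omega
    obtain rfl : i = ⟨M, hM⟩ := Fin.ext hi
    rw [Equiv.swap_apply_right, Fin.snoc_last, dif_pos (Nat.lt_succ_self M)]
    exact (Fin.snoc_last (α := fun _ => Matrix (Fin k) (Fin k) ℂ) a A).symm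
  · refine Fin.lastCases (fun hi => ?_) (fun j hi => ?_) i hi
    · have hMN : M < N := lt_of_le_of_ne h fun h => hi (by simp [h])
      rw [Equiv.swap_apply_left, dif_neg (by simp; omega),
        show (⟨M, by omega⟩ : Fin (N + 1)) = Fin.castSucc ⟨M, hMN⟩ from rfl, Fin.snoc_castSucc,
        dif_neg (lt_irrefl M)]
    · rw [Equiv.swap_apply_of_ne_of_ne (Fin.castSucc_lt_last j).ne (fun h => hi (by simp [h])),
        Fin.snoc_castSucc]
      by_cases hj : (j : ℕ) < M
      · rw [dif_pos hj, dif_pos (show (j.castSucc : ℕ) < M.succ from Nat.lt_succ_of_lt hj)]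
        exact (Fin.snoc_castSucc (α := fun _ => Matrix (Fin k) (Fin k) ℂ) a A ⟨j, hj⟩).symm
      · rw [dif_neg hj, dif_neg]
        have : (j : ℕ) ≠ M := hi
        simp only [Fin.val_castSucc]
        omega

/-- The permutation is extended to `N + 1` sites by fixing the last one, under which the family is
invariant. -/
lemma apply_append_permute (hf : IsSymmFamily f) {N : ℕ} (π : Equiv.Perm (Fin N))
    (A : SpinAlg k N) (a : Matrix (Fin k) (Fin k) ℂ) :
    f (N + 1) (append (permute π A) a) = f (N + 1) (append A a) := by
  refine LinearMap.congr_fun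
    (f := (hf.state (N + 1)).toLin ∘ₗ appendLeft N a ∘ₗ permute π)
    (g := (hf.state (N + 1)).toLin ∘ₗ appendLeft N a) (linearMap_ext_tensor fun A => ?_) A
  change f (N + 1) (append (permute π (tensor A)) a) = f (N + 1) (append (tensor A) a)
  let π' : Equiv.Perm (Fin (N + 1)) := π.viaFintypeEmbedding Fin.castSuccEmb
  have h1 : ∀ i : Fin N, π' i.castSucc = (π i).castSucc := fun i =>
    Equiv.Perm.viaFintypeEmbedding_apply_image π Fin.castSuccEmb i
  have h2 : π' (Fin.last N) = Fin.last N :=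
    Equiv.Perm.viaFintypeEmbedding_apply_notMem_range π Fin.castSuccEmb (by
      simp)
  have hinv : ∀ {n : ℕ} (p : Equiv.Perm (Fin n)) x, p⁻¹ (p x) = x := fun p x =>
    p.symm_apply_apply x
  rw [← hf.perm _ π' (append (tensor A) a), permute_tensor, append_tensor, append_tensor,
    permute_tensor]
  congr 2
  funext i
  obtain ⟨j, rfl⟩ := π'.surjective i
  refine Fin.lastCases ?_ (fun j => ?_) j
  · rw [hinv, h2, Fin.snoc_last, Fin.snoc_last]
  · rw [hinv, h1, Fin.snoc_castSucc, Fin.snoc_castSucc,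
      hinv]

lemma apply_append_one (hf : IsSymmFamily f) (N : ℕ) (a : Matrix (Fin k) (Fin k) ℂ) :
    f (N + 1) (append 1 a) = hf.site a := by
  have := hf.apply_append_embed N.zero_le 1 a
  rwa [map_one] at this

/-- Conditioning a symmetric family on a positive observable of an additional site. -/
lemma condition (hf : IsSymmFamily f) (b : Matrix (Fin k) (Fin k) ℂ) {t : ℝ} (ht : 0 < t)
    (hb : hf.site (star b * b) = t) :
    IsSymmFamily fun N A => (t : ℂ)⁻¹ * f (N + 1) (append A (star b * b)) where
  add N A B := by rw [append_add_left, hf.add, mul_add]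
  smul N c A := by rw [append_smul_left, hf.smul, mul_left_comm]
  nonneg N A := by
    rw [← append_mul, ← star_append]
    exact mul_nonneg (inv_nonneg.2 (by exact_mod_cast ht.le)) (hf.nonneg _ _)
  one N := by
    rw [hf.apply_append_one, hb, inv_mul_cancel₀ (by exact_mod_cast ht.ne')]
  embed M N h A := by rw [hf.apply_append_embed]
  perm N π A := by rw [hf.apply_append_permute]

end IsSymmFamily

/-! ### Extreme points of the set of symmetric families -/

lemma convex_isSymmFamily {k : ℕ} :
    Convex ℝ {f : ∀ N, SpinAlg k N → ℂ | IsSymmFamily f} := by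
  intro f hf g hg s t hs ht hst
  have e : ∀ N A, (s • f + t • g) N A = s * f N A + t * g N A := fun N A => by
    simp [Complex.real_smul]
  have hst' : (s : ℂ) + t = 1 := by exact_mod_cast hst
  refine ⟨fun N A B => ?_, fun N c A => ?_, fun N A => ?_, fun N => ?_, fun M N h A => ?_,
    fun N π A => ?_⟩
  · rw [e, e, e, hf.add, hg.add]; ring
  · rw [e, e, hf.smul, hg.smul]; ring
  · rw [e]
    exact add_nonneg (mul_nonneg (by exact_mod_cast hs) (hf.nonneg N A))
      (mul_nonneg (by exact_mod_cast ht) (hg.nonneg N A))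
  · rw [e, hf.one, hg.one, mul_one, mul_one, hst']
  · rw [e, e, hf.embed, hg.embed]
  · rw [e, e, hf.perm, hg.perm]

/-- Tychonoff again: the defining conditions are closed and states have norm at most one.
Compactness is in the product topology, a locally convex topology in which Krein–Milman applies. -/
lemma isCompact_isSymmFamily {k : ℕ} :
    IsCompact {f : ∀ N, SpinAlg k N → ℂ | IsSymmFamily f} := by
  have hK : IsCompact (Set.univ.pi fun N : ℕ => Set.univ.pi fun A : SpinAlg k N =>
      Metric.closedBall (0 : ℂ) ‖A‖) :=
    isCompact_univ_pi fun N => isCompact_univ_pi fun A => isCompact_closedBall _ _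
  refine hK.of_isClosed_subset ?_ fun f hf N _ A _ => ?_
  · have : {f : ∀ N, SpinAlg k N → ℂ | IsSymmFamily f} = {f | (∀ N A B, f N (A + B) = f N A + f N B)
        ∧ (∀ N (c : ℂ) A, f N (c • A) = c * f N A) ∧ (∀ N A, 0 ≤ f N (star A * A)) ∧
        (∀ N, f N 1 = 1) ∧ (∀ M N (h : M ≤ N) A, f N (embed h A) = f M A) ∧
        (∀ N (π : Equiv.Perm (Fin N)) A, f N (permute π A) = f N A)} := by
      ext f
      exact ⟨fun ⟨h1, h2, h3, h4, h5, h6⟩ => ⟨h1, h2, h3, h4, h5, h6⟩,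
        fun ⟨h1, h2, h3, h4, h5, h6⟩ => ⟨h1, h2, h3, h4, h5, h6⟩⟩
    rw [this]
    simp only [Set.ofPred_and, Set.ofPred_forall]
    refine IsClosed.inter ?_ (IsClosed.inter ?_ (IsClosed.inter ?_ (IsClosed.inter ?_
      (IsClosed.inter ?_ ?_))))
    · exact isClosed_iInter fun N => isClosed_iInter fun A => isClosed_iInter fun B =>
        isClosed_eq (by fun_prop) (by fun_prop)
    · exact isClosed_iInter fun N => isClosed_iInter fun c => isClosed_iInter fun A =>
        isClosed_eq (by fun_prop) (by fun_prop)
    · exact isClosed_iInter fun N => isClosed_iInter fun A =>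
        isClosed_le (by fun_prop) (by fun_prop)
    · exact isClosed_iInter fun N => isClosed_eq (by fun_prop) (by fun_prop)
    · exact isClosed_iInter fun M => isClosed_iInter fun N => isClosed_iInter fun h =>
        isClosed_iInter fun A => isClosed_eq (by fun_prop) (by fun_prop)
    · exact isClosed_iInter fun N => isClosed_iInter fun π => isClosed_iInter fun A =>
        isClosed_eq (by fun_prop) (by fun_prop)
  · rw [mem_closedBall_zero_iff]
    exact (hf.state N).norm_apply_le A

/-- The family is the average, with weights `t` and `1 - t`, of its conditionings on b* b and on c*
c. By extremality the first of them equals the family, which is the asserted factorization divided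
by `t`. -/
lemma apply_append_of_mem_extremePoints_of_pos {k : ℕ} {f : ∀ N, SpinAlg k N → ℂ}
    (hf : f ∈ {f : ∀ N, SpinAlg k N → ℂ | IsSymmFamily f}.extremePoints ℝ)
    {b c : Matrix (Fin k) (Fin k) ℂ} (hbc : star b * b + star c * c = 1) {t : ℝ}
    (ht0 : 0 < t) (ht1 : t < 1) (ht : hf.1.site (star b * b) = t) (N : ℕ) (A : SpinAlg k N) :
    f (N + 1) (append A (star b * b)) = hf.1.site (star b * b) * f N A := by
  have hs : hf.1.site (star c * c) = (1 - t : ℝ) := by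
    rw [← eq_sub_iff_add_eq'] at hbc
    rw [hbc, map_sub, hf.1.site.map_one', ht]; simp
  have h := hf.2 (hf.1.condition b ht0 ht) (hf.1.condition c (sub_pos.2 ht1) hs)
    ⟨t, 1 - t, ht0, sub_pos.2 ht1, by ring, ?_⟩
  · have h2 := congrFun (congrFun h N) A
    rw [ht, ← h2, mul_inv_cancel_left₀ (by exact_mod_cast ht0.ne')]
  · funext N A
    have h1 : ((1 - t : ℝ) : ℂ) ≠ 0 := by exact_mod_cast (sub_pos.2 ht1).ne'
    have h0 : (t : ℂ) ≠ 0 := by exact_mod_cast ht0.ne'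
    simp only [Pi.add_apply, Pi.smul_apply, Complex.real_smul]
    rw [mul_inv_cancel_left₀ h0, mul_inv_cancel_left₀ h1, ← hf.1.add, ← append_add_right, hbc,
      append_one, hf.1.embed]

lemma apply_append_of_mem_extremePoints {k : ℕ} {f : ∀ N, SpinAlg k N → ℂ}
    (hf : f ∈ {f : ∀ N, SpinAlg k N → ℂ | IsSymmFamily f}.extremePoints ℝ)
    (N : ℕ) (A : SpinAlg k N) (a : Matrix (Fin k) (Fin k) ℂ) :
    f (N + 1) (append A a) = hf.1.site a * f N A := by
  -- The defect of factorization is linear in `a` and vanishes at 1, so it suffices to kill it on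
  -- small self-adjoint `a`.
  let L : Matrix (Fin k) (Fin k) ℂ →ₗ[ℂ] ℂ :=
    { toFun := fun a => f (N + 1) (append A a) - hf.1.site a * f N A
      map_add' := fun a b => by rw [append_add_right, hf.1.add, map_add]; ring
      map_smul' := fun c a => by
        rw [append_smul_right, hf.1.smul, map_smul, smul_eq_mul, RingHom.id_apply, smul_eq_mul]
        ring }
  have hL1 : L 1 = 0 := by
    change f (N + 1) (append A 1) - hf.1.site 1 * f N A = 0
    rw [append_one, hf.1.embed, hf.1.site.map_one', one_mul, sub_self]
  -- Here 1/2 + a and 1/2 - a are positive and sum to 1. The bound 1/4 also keeps the weight 1/2 +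
  -- Re ρ(a), where ρ is the one-site marginal, inside [1/4, 3/4], hence strictly between 0 and 1.
  have hsmall : ∀ a : Matrix (Fin k) (Fin k) ℂ, IsSelfAdjoint a → ‖a‖ ≤ 1 / 4 → L a = 0 := by
    intro a ha hn
    have hle : ∀ b : Matrix (Fin k) (Fin k) ℂ, IsSelfAdjoint b → ‖b‖ ≤ 1 / 4 →
        ∃ c, (1 / 2 : ℂ) • 1 + b = star c * c := by
      intro b hb hn
      refine CStarAlgebra.nonneg_iff_eq_star_mul_self.1 ?_
      have h1 := hb.neg_algebraMap_norm_le_self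
      have h2 : algebraMap ℝ (Matrix (Fin k) (Fin k) ℂ) ‖b‖ ≤ algebraMap ℝ _ (1 / 2) :=
        algebraMap_mono _ (by linarith)
      have h3 : (1 / 2 : ℂ) • (1 : Matrix (Fin k) (Fin k) ℂ) = algebraMap ℝ _ (1 / 2) := by
        rw [Algebra.algebraMap_eq_smul_one, ← Complex.coe_smul]; norm_num
      rw [h3]
      have := add_le_add h2 h1
      rwa [add_neg_cancel] at this
    obtain ⟨b, hb⟩ := hle a ha hn
    obtain ⟨c, hc⟩ := hle (-a) ha.neg (by rwa [norm_neg])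
    have hbc : star b * b + star c * c = 1 := by
      rw [← hb, ← hc, add_add_add_comm, add_neg_cancel, add_zero, ← add_smul]; norm_num
    have him : (hf.1.site a).im = 0 := by
      have := hf.1.site.map_star a
      rw [ha.star_eq] at this
      exact Complex.conj_eq_iff_im.1 this.symm
    have hre : |(hf.1.site a).re| ≤ 1 / 4 :=
      (Complex.abs_re_le_norm _).trans ((hf.1.site.norm_apply_le a).trans hn)
    have ht : hf.1.site (star b * b) = ((1 / 2 + (hf.1.site a).re : ℝ) : ℂ) := by
      rw [← hb, map_add, map_smul, hf.1.site.map_one']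
      apply Complex.ext <;> simp [him]
    have h := apply_append_of_mem_extremePoints_of_pos hf hbc (by linarith [abs_le.1 hre])
      (by linarith [abs_le.1 hre]) ht N A
    have h' : L (star b * b) = 0 := sub_eq_zero.2 h
    rw [← hb, map_add, map_smul, hL1, smul_zero, zero_add] at h'
    exact h'
  have hsa : ∀ a : Matrix (Fin k) (Fin k) ℂ, IsSelfAdjoint a → L a = 0 := by
    intro a ha
    have hpos : 0 < 4 * (‖a‖ + 1) := by positivity
    have h := hsmall (((4 * (‖a‖ + 1))⁻¹ : ℝ) • a) ((IsSelfAdjoint.all _).smul ha) (by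
      rw [norm_smul, Real.norm_of_nonneg (by positivity), inv_mul_le_iff₀ hpos]
      linarith)
    rw [← Complex.coe_smul, map_smul, smul_eq_mul, mul_eq_zero] at h
    exact h.resolve_left (by exact_mod_cast (inv_pos.2 hpos).ne')
  have h : L a = 0 := by
    rw [← realPart_add_I_smul_imaginaryPart a, map_add, map_smul, hsa _ (realPart a).2,
      hsa _ (imaginaryPart a).2, smul_zero, add_zero]
  exact sub_eq_zero.1 h

/-- The extreme symmetric families are the product states. -/
lemma eq_prodFun_of_mem_extremePoints {k : ℕ} {f : ∀ N, SpinAlg k N → ℂ}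
    (hf : f ∈ {f : ∀ N, SpinAlg k N → ℂ | IsSymmFamily f}.extremePoints ℝ)
    (N : ℕ) (A : SpinAlg k N) : f N A = prodFun hf.1.site N A := by
  refine LinearMap.congr_fun (f := (hf.1.state N).toLin) (g := prodFun hf.1.site N)
    (linearMap_ext_tensor fun B => ?_) A
  rw [prodFun_tensor]
  change f N (tensor B) = _
  clear A
  induction N with
  | zero =>
    rw [show tensor B = 1 by rw [← tensor_one]; congr 1; exact Subsingleton.elim _ _, hf.1.one]
    simp
  | succ N ih =>
    rw [← Fin.snoc_init_self B, ← append_tensor, apply_append_of_mem_extremePoints hf,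
      ih, Fin.prod_univ_castSucc, mul_comm]
    simp

/-- Krein–Milman: the families coming from states of C(X) form a compact convex set, and this set
contains all extreme families, which come from Dirac states. Working with states of C(X) rather than
measures makes both compactness and convexity immediate. -/
lemma exists_state_of_isSymmFamily {k : ℕ} {f : ∀ N, SpinAlg k N → ℂ} (hf : IsSymmFamily f) :
    ∃ φ : State C(SiteState k, ℂ), ∀ N A, f N A = φ (prodEval k N A) := by
  let F : State C(SiteState k, ℂ) → ∀ N, SpinAlg k N → ℂ := fun φ N A => φ (prodEval k N A)
  have hF : Continuous F :=
    continuous_pi fun N => continuous_pi fun A => State.continuous_eval _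
  have hconv : Convex ℝ (Set.range F) := by
    rintro _ ⟨φ, rfl⟩ _ ⟨ψ, rfl⟩ s t hs ht hst
    obtain rfl : t = 1 - s := by linarith
    refine ⟨State.mix s hs (by linarith) φ ψ, ?_⟩
    funext N A
    simp [F, State.mix_apply, Complex.real_smul]
  have hsub : {f : ∀ N, SpinAlg k N → ℂ | IsSymmFamily f} ⊆ Set.range F := by
    rw [← closure_convexHull_extremePoints isCompact_isSymmFamily convex_isSymmFamily]
    refine closure_minimal (convexHull_min ?_ hconv) (isCompact_range hF).isClosed
    intro f hf
    refine ⟨State.dirac hf.1.site, ?_⟩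
    funext N A
    exact (eq_prodFun_of_mem_extremePoints hf N A).symm
  obtain ⟨φ, hφ⟩ := hsub hf
  exact ⟨φ, fun N A => (congrFun (congrFun hφ N) A).symm⟩

/-! ### The de Finetti homeomorphism -/

lemma IsPermInvariant.isSymmFamily {k : ℕ} {ω : State (QuasiLocalAlg k)}
    (hω : IsPermInvariant ω) : IsSymmFamily fun N A => restrict ω N A where
  add N := (restrict ω N).map_add
  smul N := (restrict ω N).map_smul
  nonneg N A := by
    change 0 ≤ ω (localEmbed k N _)
    rw [localEmbed_star_mul_self]
    exact ω.nonneg' _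
  one N := by
    change ω (localEmbed k N 1) = 1
    rw [localEmbed_one, ω.map_one']
  embed M N h A := congrArg ω.toLin (localEmbed_embed h A)
  -- The symmetrizer absorbs any single permutation, so invariance under the average implies
  -- invariance under each permutation.
  perm N π A := by
    rw [← hω N, LinearMap.comp_apply, symmetrizer_permute]; rfl

/-- **Quantum de Finetti theorem**: a permutation-invariant state is a mixture of product
states. -/
lemma exists_mixture_eq {k : ℕ} {ω : State (QuasiLocalAlg k)} (hω : IsPermInvariant ω) :
    ∃ φ, mixture φ = ω := by
  obtain ⟨φ, hφ⟩ := exists_state_of_isSymmFamily hω.isSymmFamily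
  refine ⟨φ, state_ext_restrict fun N => ?_⟩
  rw [restrict_mixture]
  ext1 A
  exact (hφ N A).symm

/-- The homeomorphism between permutation-invariant states and states on `C(S(M_k(ℂ)))`. -/
def permInvHomeo (k : ℕ) : PermInvState k ≃ₜ State C(SiteState k, ℂ) :=
  (IsHomeomorph.homeomorph
    (fun φ : State C(SiteState k, ℂ) => (⟨mixture φ, isPermInvariant_mixture φ⟩ : PermInvState k))
    -- The source is compact and the target Hausdorff, so continuity of the inverse is automatic.
    (isHomeomorph_iff_continuous_bijective.2 ⟨continuous_mixture.subtype_mk _,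
      fun φ ψ h => mixture_injective (congrArg Subtype.val h), fun ω => by
        obtain ⟨φ, hφ⟩ := exists_mixture_eq ω.2
        exact ⟨φ, Subtype.ext hφ⟩⟩)).symm

lemma mixture_permInvHomeo {k : ℕ} (ω : PermInvState k) : mixture (permInvHomeo k ω) = ω.1 :=
  congrArg Subtype.val ((permInvHomeo k).symm_apply_apply ω)

/-! ### States on `C(X)` and probability measures -/

section Riesz

variable {X : Type*} [TopologicalSpace X] [CompactSpace X] [MeasurableSpace X] [BorelSpace X]

lemma integrable_of_continuousMap (μ : Measure X) [IsFiniteMeasure μ] (f : C(X, ℂ)) :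
    Integrable f μ :=
  f.continuous.integrable_of_hasCompactSupport (HasCompactSupport.of_compactSpace f)

/-- Integration against a probability measure, as a state. -/
def integralState (μ : ProbabilityMeasure X) : State C(X, ℂ) where
  toLin :=
    { toFun := fun f => ∫ x, f x ∂(μ : Measure X)
      map_add' := fun f g => integral_add (integrable_of_continuousMap _ f)
        (integrable_of_continuousMap _ g)
      map_smul' := fun c f => integral_smul c f }
  nonneg' f := by
    have h : ∀ x, (star f * f) x = ((‖f x‖ ^ 2 : ℝ) : ℂ) := fun x => by
      rw [Complex.ofReal_pow]; exact Complex.conj_mul' (f x)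
    change 0 ≤ ∫ x, (star f * f) x ∂(μ : Measure X)
    simp only [h]
    rw [integral_complex_ofReal]
    exact_mod_cast integral_nonneg fun x => by positivity
  map_one' := by
    change ∫ x, (1 : ℂ) ∂(μ : Measure X) = 1
    simp

lemma integralState_apply (μ : ProbabilityMeasure X) (f : C(X, ℂ)) :
    integralState μ f = ∫ x, f x ∂(μ : Measure X) := rfl

lemma integralState_injective [HasOuterApproxClosed X] :
    Function.Injective (integralState (X := X)) := by
  intro μ ν h
  apply Subtype.ext
  have := μ.2
  have := ν.2
  refine ext_of_forall_integral_eq_of_IsFiniteMeasure fun f => ?_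
  have h1 := congrArg (fun φ : State C(X, ℂ) => φ ⟨fun x => (f x : ℂ), by fun_prop⟩) h
  simp only [integralState_apply, ContinuousMap.coe_mk, integral_complex_ofReal] at h1
  exact_mod_cast h1

/-- **Riesz representation** of states on `C(X)`. -/
lemma integralState_surjective [T2Space X] : Function.Surjective (integralState (X := X)) := by
  intro φ
  -- The Riesz theorem is used for real functions: `Λ` is the real part of `φ` on them, and nothing
  -- is lost because `φ` is real there. Complex functions are recovered at the end from real and
  -- imaginary parts.
  let r : C_c(X, ℝ) →ₗ[ℝ] C(X, ℂ) :=
    { toFun := fun g => ⟨fun x => (g x : ℂ), by fun_prop⟩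
      map_add' := fun g g' => by ext x; simp
      map_smul' := fun c g => by ext x; simp }
  let Λ : C_c(X, ℝ) →ₚ[ℝ] ℝ := PositiveLinearMap.mk₀
    (Complex.reLm ∘ₗ φ.toLin.restrictScalars ℝ ∘ₗ r) fun g hg =>
      (Complex.nonneg_iff.1 (φ.apply_nonneg (f := r g) fun x => by
        change (0 : ℂ) ≤ ((g x : ℝ) : ℂ)
        exact_mod_cast hg x)).1
  let μ := RealRMK.rieszMeasure Λ
  have hμ : ∀ g : C_c(X, ℝ), φ (r g) = ∫ x, (g x : ℂ) ∂μ := fun g => by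
    rw [integral_complex_ofReal, RealRMK.integral_rieszMeasure]
    exact Complex.ext rfl (φ.apply_im_eq_zero fun x => Complex.ofReal_im _)
  have hone : IsProbabilityMeasure μ := by
    have h := hμ ⟨1, HasCompactSupport.of_compactSpace 1⟩
    rw [show r ⟨1, HasCompactSupport.of_compactSpace 1⟩ = 1 from
      ContinuousMap.ext fun x => Complex.ofReal_one, φ.map_one'] at h
    have h2 : (1 : ℂ) = ∫ x, (1 : ℂ) ∂μ :=
      h.trans (integral_congr_ae (.of_forall fun x => Complex.ofReal_one))
    rw [integral_const] at h2
    simp only [Complex.real_smul, mul_one] at h2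
    have h3 : μ.real Set.univ = 1 := by exact_mod_cast h2.symm
    exact ⟨by rw [← ENNReal.ofReal_toReal (measure_ne_top μ Set.univ)]
              exact (congrArg ENNReal.ofReal h3).trans ENNReal.ofReal_one⟩
  refine ⟨⟨μ, hone⟩, State.ext_apply fun f => ?_⟩
  let re : C_c(X, ℝ) := ⟨⟨fun x => (f x).re, by fun_prop⟩, HasCompactSupport.of_compactSpace _⟩
  let im : C_c(X, ℝ) := ⟨⟨fun x => (f x).im, by fun_prop⟩, HasCompactSupport.of_compactSpace _⟩
  have hf : f = r re + Complex.I • r im := by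
    ext x
    change f x = ((f x).re : ℂ) + Complex.I * ((f x).im : ℂ)
    rw [mul_comm, Complex.re_add_im]
  rw [hf, map_add, map_add, map_smul, map_smul, hμ, hμ]
  rfl

end Riesz

/-- Integrability is automatic because ρ ↦ ρ^{⊗∞}(a) is continuous on a compact space. Existence and
uniqueness of the measure thereby reduce to bijectivity of `mixture` and `integralState`. -/
lemma isDeFinettiMeasure_iff {k : ℕ} (ω : State (QuasiLocalAlg k))
    (μ : ProbabilityMeasure (SiteState k)) :
    IsDeFinettiMeasure ω μ ↔ mixture (integralState μ) = ω := by
  constructor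
  · exact fun h => State.ext_apply fun a => (h a).2.symm
  · rintro rfl a
    exact ⟨integrable_of_continuousMap _ (quasiEval k a), rfl⟩

/-! ### Von Neumann entropy -/

section Entropy

variable {n : Type*} [Fintype n] [DecidableEq n]

lemma State.posSemidef_density (φ : State (Matrix n n ℂ)) : (density φ.toLin).PosSemidef := by
  have key : ∀ x : n → ℂ, star x ⬝ᵥ (density φ.toLin).mulVec x
      = φ (Matrix.vecMulVec x (star x)) := by
    intro x
    rw [← trace_density_mul φ.toLin, Matrix.mul_vecMulVec, Matrix.trace_vecMulVec, dotProduct_comm]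
  refine Matrix.PosSemidef.of_dotProduct_mulVec_nonneg ?_ fun x => ?_
  · ext i j
    simp only [Matrix.conjTranspose_apply, density, Matrix.of_apply]
    rw [show star (φ.toLin (Matrix.single i j 1)) = _ from (State.map_star φ _).symm]
    simp [Matrix.star_eq_conjTranspose]
  · rw [key]
    obtain ⟨B, hB⟩ := CStarAlgebra.nonneg_iff_eq_star_mul_self.1
      (Matrix.nonneg_iff_posSemidef.2 (Matrix.posSemidef_vecMulVec_self_star x))
    rw [hB]
    exact φ.nonneg' B

lemma State.trace_density (φ : State (Matrix n n ℂ)) : (density φ.toLin).trace = 1 := by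
  rw [← mul_one (density φ.toLin), trace_density_mul, φ.map_one']

lemma State.re_apply_le (φ : State (Matrix n n ℂ)) {A B : Matrix n n ℂ} (h : A ≤ B) :
    (φ A).re ≤ (φ B).re := by
  obtain ⟨C, hC⟩ := CStarAlgebra.nonneg_iff_eq_star_mul_self.1 (sub_nonneg.2 h)
  have h1 := (Complex.nonneg_iff.1 (φ.nonneg' C)).1
  rw [← hC, map_sub, Complex.sub_re] at h1
  linarith

lemma entropy_eq_neg_re_apply_log (φ : Matrix n n ℂ →ₗ[ℂ] ℂ) :
    entropy φ = -(φ (cfc Real.log (density φ))).re := by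
  rw [entropy, trace_density_mul]

/-- The spectrum is finite, so functional calculus applies to every function, in particular to the
logarithm at singular density matrices. -/
lemma continuousOn_spectrum (f : ℝ → ℝ) (D : Matrix n n ℂ) : ContinuousOn f (spectrum ℝ D) :=
  (Matrix.finite_real_spectrum (A := D)).continuousOn f

lemma mul_cfc_log {D : Matrix n n ℂ} (hD : D.IsHermitian) :
    D * cfc Real.log D = cfc (fun x => x * Real.log x) D := by
  rw [cfc_mul _ _ _ (continuousOn_spectrum _ D) (continuousOn_spectrum _ D),
    cfc_id' ℝ D hD.isSelfAdjoint]

/-- The logarithm is discontinuous at 0, but x log x is continuous, and the entropy depends on the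
density matrix only through the latter. -/
lemma continuous_entropy : Continuous fun φ : State (Matrix n n ℂ) => entropy φ.toLin := by
  have h0 : ∀ φ : State (Matrix n n ℂ), entropy φ.toLin
      = -(cfc (fun x => x * Real.log x) (density φ.toLin)).trace.re := fun φ => by
    rw [entropy, mul_cfc_log φ.posSemidef_density.1]
  simp only [h0]
  -- A common norm bound confines the spectra of all density matrices to one compact set, as
  -- continuity of the functional calculus in the matrix requires.
  obtain ⟨R, hR⟩ := isCompact_univ.exists_bound_of_continuousOn
    (continuous_density (n := n)).continuousOn
  have h1 : Continuous fun φ : State (Matrix n n ℂ) =>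
      cfc (fun x => x * Real.log x) (density φ.toLin) := by
    refine Continuous.cfc' (isCompact_closedBall (0 : ℝ) (R * ‖(1 : Matrix n n ℂ)‖)) _
      continuous_density (fun φ => ?_) Real.continuous_mul_log.continuousOn
      (fun φ => φ.posSemidef_density.1.isSelfAdjoint)
    refine (spectrum.subset_closedBall_norm_mul _).trans (Metric.closedBall_subset_closedBall ?_)
    gcongr
    exact hR φ trivial
  exact (Complex.continuous_re.comp (h1.matrix_trace)).neg

/-- The trace of a product of functions of two Hermitian matrices, in terms of the transition
probabilities between their eigenbases. -/
lemma trace_cfc_mul_cfc {D T : Matrix n n ℂ} (hD : D.IsHermitian) (hT : T.IsHermitian)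
    (f g : ℝ → ℝ) : (cfc f D * cfc g T).trace = ((∑ i, ∑ j, f (hD.eigenvalues i) *
      g (hT.eigenvalues j) * ‖(star (hD.eigenvectorUnitary : Matrix n n ℂ) *
        (hT.eigenvectorUnitary : Matrix n n ℂ)) i j‖ ^ 2 : ℝ) : ℂ) := by
  rw [hD.cfc_eq, hT.cfc_eq, Matrix.IsHermitian.cfc, Matrix.IsHermitian.cfc,
    Unitary.conjStarAlgAut_apply, Unitary.conjStarAlgAut_apply]
  generalize (hD.eigenvectorUnitary : Matrix n n ℂ) = U
  generalize (hT.eigenvectorUnitary : Matrix n n ℂ) = V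
  have e : ∀ F G : Matrix n n ℂ, (U * F * star U * (V * G * star V)).trace
      = (F * (star U * V) * G * star (star U * V)).trace := fun F G => by
    rw [star_mul, star_star, mul_assoc U, mul_assoc U, Matrix.trace_mul_comm]
    simp only [mul_assoc]
  rw [e]
  generalize star U * V = W
  rw [Matrix.trace]
  simp only [Matrix.diag_apply]
  push_cast
  refine Finset.sum_congr rfl fun i _ => ?_
  rw [Matrix.mul_apply]
  refine Finset.sum_congr rfl fun j _ => ?_
  rw [← Complex.mul_conj', Matrix.star_apply, Matrix.mul_diagonal, Matrix.diagonal_mul]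
  change ((f _ : ℝ) : ℂ) * _ * ((g _ : ℝ) : ℂ) * _ = _ * _ * (_ * star _)
  ring

/-- This is log x ≤ x - 1 at x = t/d, multiplied by d; it is the scalar form of Klein's inequality.
-/
lemma sub_le_mul_log_sub {d t : ℝ} (hd : 0 ≤ d) (ht : 0 < t) :
    d - t ≤ d * Real.log d - d * Real.log t := by
  rcases hd.eq_or_lt with rfl | hd
  · simp [ht.le]
  · have h := Real.log_le_sub_one_of_pos (div_pos ht hd)
    rw [Real.log_div ht.ne' hd.ne'] at h
    have h2 := mul_le_mul_of_nonneg_left h hd.le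
    rw [mul_sub, mul_sub, mul_div_cancel₀ _ hd.ne', mul_one] at h2
    linarith

/-- **Klein's inequality**. -/
lemma entropy_le_of_posDef (φ : State (Matrix n n ℂ)) {T : Matrix n n ℂ} (hT : T.PosDef)
    (hT1 : T.trace = 1) : entropy φ.toLin ≤ -(φ (cfc Real.log T)).re := by
  obtain ⟨D, hDdef⟩ : ∃ D, D = density φ.toLin := ⟨_, rfl⟩
  have hD : D.PosSemidef := hDdef ▸ φ.posSemidef_density
  have htr : ∀ L, (D * L).trace = φ L := hDdef ▸ trace_density_mul φ.toLin
  have hD1 : D.trace = 1 := hDdef ▸ φ.trace_density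
  -- Tr D log D, Tr D log T, Tr D and Tr T become double sums with the same nonnegative transition
  -- weights, so they can be compared term by term.
  have h1 := trace_cfc_mul_cfc hD.1 hT.1 (fun x => x * Real.log x) (fun _ => 1)
  have h2 := trace_cfc_mul_cfc hD.1 hT.1 (fun x => x) Real.log
  have h3 := trace_cfc_mul_cfc hD.1 hT.1 (fun x => x) (fun _ => 1)
  have h4 := trace_cfc_mul_cfc hD.1 hT.1 (fun _ => 1) (fun x => x)
  rw [cfc_id' ℝ D hD.1.isSelfAdjoint, htr] at h2
  rw [cfc_const_one ℝ T hT.1.isSelfAdjoint, mul_one, ← mul_cfc_log hD.1] at h1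
  rw [cfc_const_one ℝ T hT.1.isSelfAdjoint, cfc_id' ℝ D hD.1.isSelfAdjoint, mul_one, hD1] at h3
  rw [cfc_const_one ℝ D hD.1.isSelfAdjoint, cfc_id' ℝ T hT.1.isSelfAdjoint, one_mul, hT1] at h4
  have h34 := Complex.ofReal_injective (h3.symm.trans h4)
  rw [entropy, ← hDdef, h1, h2, Complex.ofReal_re, Complex.ofReal_re, neg_le_neg_iff,
    ← sub_nonneg]
  -- The zero on the left is replaced by Tr D - Tr T, supplying the term d - t of the scalar
  -- inequality.
  rw [← sub_eq_zero] at h34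
  rw [← h34, ← Finset.sum_sub_distrib, ← Finset.sum_sub_distrib]
  refine Finset.sum_le_sum fun i _ => ?_
  rw [← Finset.sum_sub_distrib, ← Finset.sum_sub_distrib]
  refine Finset.sum_le_sum fun j _ => ?_
  rw [← sub_mul, ← sub_mul, mul_one, one_mul, mul_one]
  exact mul_le_mul_of_nonneg_right
    (sub_le_mul_log_sub (hD.eigenvalues_nonneg i) (hT.eigenvalues_pos j)) (by positivity)

/-- The eigenvalues lie in [0, 1], where the logarithm is nonpositive; the convention log 0 = 0 is
harmless here. -/
lemma re_trace_cfc_log_nonpos {D : Matrix n n ℂ} (hD : D.PosSemidef) (h1 : D.trace = 1) :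
    (cfc Real.log D).trace.re ≤ 0 := by
  have h := trace_cfc_mul_cfc hD.1 hD.1 Real.log (fun _ => 1)
  rw [cfc_const_one ℝ D hD.1.isSelfAdjoint, mul_one] at h
  rw [h, Complex.ofReal_re]
  have hsum : ∑ i, hD.1.eigenvalues i = 1 := by
    have := hD.1.trace_eq_sum_eigenvalues
    rw [h1] at this
    apply Complex.ofReal_injective
    rw [Complex.ofReal_sum]
    exact this.symm
  refine Finset.sum_nonpos fun i _ => Finset.sum_nonpos fun j _ => ?_
  have hle : hD.1.eigenvalues i ≤ 1 := by
    rw [← hsum]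
    exact Finset.single_le_sum (fun i _ => hD.eigenvalues_nonneg i) (Finset.mem_univ i)
  rw [mul_one]
  exact mul_nonpos_of_nonpos_of_nonneg (Real.log_nonpos (hD.eigenvalues_nonneg i) hle)
    (by positivity)

/-! ### Approximation by faithful states -/

section depolarize

variable [Nonempty n]

/-- The normalised trace. -/
def tracialState (n : Type*) [Fintype n] [DecidableEq n] [Nonempty n] : State (Matrix n n ℂ) where
  toLin := ((Fintype.card n : ℂ))⁻¹ • Matrix.traceLinearMap n ℂ ℂ
  nonneg' A := mul_nonneg (inv_nonneg.2 (Nat.cast_nonneg _))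
    (Matrix.posSemidef_conjTranspose_mul_self A).trace_nonneg
  map_one' := by
    simp [Matrix.trace_one]

/-- The weights `(m + 1) / (m + 2)`. -/
def depolarizeWeight (m : ℕ) : ℝ := (m + 1) / (m + 2)

lemma depolarizeWeight_pos (m : ℕ) : 0 < depolarizeWeight m := by
  unfold depolarizeWeight; positivity

lemma depolarizeWeight_lt_one (m : ℕ) : depolarizeWeight m < 1 := by
  unfold depolarizeWeight
  rw [div_lt_one (by positivity)]
  linarith

lemma tendsto_depolarizeWeight : Tendsto depolarizeWeight atTop (𝓝 1) := by
  have h := (tendsto_natCast_div_add_atTop (1 : ℝ)).comp (tendsto_add_atTop_nat 1)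
  refine h.congr fun m => ?_
  simp only [Function.comp_apply, depolarizeWeight]
  push_cast
  congr 1
  ring

/-- A faithful state close to `φ`. -/
def depolarize (m : ℕ) (φ : State (Matrix n n ℂ)) : State (Matrix n n ℂ) :=
  State.mix (depolarizeWeight m) (depolarizeWeight_pos m).le (depolarizeWeight_lt_one m).le φ
    (tracialState n)

lemma depolarize_apply (m : ℕ) (φ : State (Matrix n n ℂ)) (A : Matrix n n ℂ) :
    depolarize m φ A = depolarizeWeight m * φ A +
      ((1 - depolarizeWeight m : ℝ) : ℂ) * (((Fintype.card n : ℂ))⁻¹ * A.trace) := rfl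

lemma posDef_density_depolarize (m : ℕ) (φ : State (Matrix n n ℂ)) :
    (density (depolarize m φ).toLin).PosDef := by
  have h : density (depolarize m φ).toLin = (depolarizeWeight m : ℂ) • density φ.toLin +
      (((1 - depolarizeWeight m : ℝ) : ℂ) * ((Fintype.card n : ℂ))⁻¹) • 1 := by
    ext i j
    change depolarize m φ (Matrix.single j i 1) = _
    rw [depolarize_apply]
    simp only [density, Matrix.add_apply, Matrix.smul_apply, Matrix.of_apply, smul_eq_mul,
      mul_assoc, Matrix.one_apply]
    congr 3
    rcases eq_or_ne i j with rfl | hij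
    · simp
    · rw [Matrix.trace_single_eq_of_ne _ _ _ hij.symm, if_neg hij]
  rw [h]
  refine Matrix.PosDef.posSemidef_add (φ.posSemidef_density.smul ?_) (Matrix.PosDef.one.smul ?_)
  · exact_mod_cast (depolarizeWeight_pos m).le
  · refine mul_pos (by exact_mod_cast sub_pos.2 (depolarizeWeight_lt_one m)) (inv_pos.2 ?_)
    exact_mod_cast Fintype.card_pos

lemma tendsto_depolarize (φ : State (Matrix n n ℂ)) :
    Tendsto (fun m => depolarize m φ) atTop (𝓝 φ) := by
  refine State.isEmbedding_coe.tendsto_nhds_iff.2 (tendsto_pi_nhds.2 fun A => ?_)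
  have h1 := (Complex.continuous_ofReal.tendsto 1).comp tendsto_depolarizeWeight
  have h2 := (Complex.continuous_ofReal.tendsto (1 - 1)).comp
    (tendsto_const_nhds.sub tendsto_depolarizeWeight)
  have h3 := (h1.mul_const (φ A)).add
    (h2.mul_const (((Fintype.card n : ℂ))⁻¹ * A.trace))
  have e : ((1 : ℝ) : ℂ) * φ A + ((1 - 1 : ℝ) : ℂ) * (((Fintype.card n : ℂ))⁻¹ * A.trace) = φ A := by
    simp
  rw [e] at h3
  exact h3

/-- The relative entropy of `φ` with respect to its depolarization is small. -/
lemma neg_re_apply_log_depolarize_le (m : ℕ) (φ : State (Matrix n n ℂ)) :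
    -(φ (cfc Real.log (density (depolarize m φ).toLin))).re
      ≤ entropy (depolarize m φ).toLin / depolarizeWeight m := by
  rw [le_div_iff₀ (depolarizeWeight_pos m), entropy_eq_neg_re_apply_log, depolarize_apply]
  -- With σ = wφ + (1 - w)τ, τ the normalised trace, S(σ) = -wφ(log σ) - (1 - w)τ(log σ), and the
  -- last term is nonnegative, so it may be dropped.
  have h := re_trace_cfc_log_nonpos (depolarize m φ).posSemidef_density
    (depolarize m φ).trace_density
  have hc : 0 ≤ (1 - depolarizeWeight m) * ((Fintype.card n : ℝ))⁻¹ :=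
    mul_nonneg (sub_pos.2 (depolarizeWeight_lt_one m)).le (by positivity)
  have h2 := mul_nonpos_of_nonneg_of_nonpos hc h
  rw [← mul_assoc, ← Complex.ofReal_natCast, ← Complex.ofReal_inv, ← Complex.ofReal_mul,
    Complex.add_re, Complex.re_ofReal_mul, Complex.re_ofReal_mul]
  linarith

lemma tendsto_entropy_depolarize_div (φ : State (Matrix n n ℂ)) :
    Tendsto (fun m => entropy (depolarize m φ).toLin / depolarizeWeight m) atTop
      (𝓝 (entropy φ.toLin)) := by
  have h := ((continuous_entropy.tendsto φ).comp (tendsto_depolarize φ)).div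
    tendsto_depolarizeWeight one_ne_zero
  rwa [div_one] at h

end depolarize

end Entropy

/-! ### Logarithms of product density matrices -/

section TensorLog

variable {k N : ℕ}

lemma tensor_update_apply (A : Fin N → Matrix (Fin k) (Fin k) ℂ) (i : Fin N)
    (a : Matrix (Fin k) (Fin k) ℂ) (σ τ : Fin N → Fin k) :
    tensor (Function.update A i a) σ τ
      = a (σ i) (τ i) * ∏ j ∈ Finset.univ.erase i, A j (σ j) (τ j) := by
  rw [tensor, Matrix.of_apply, ← Finset.mul_prod_erase _ _ (Finset.mem_univ i),
    Function.update_self]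
  congr 1
  exact Finset.prod_congr rfl fun j hj => by
    rw [Function.update_of_ne (Finset.ne_of_mem_erase hj)]

/-- The observable acting as `a` on the site `i` and trivially on the other sites. -/
def siteHom (N : ℕ) (i : Fin N) : Matrix (Fin k) (Fin k) ℂ →ₐ[ℂ] SpinAlg k N :=
  AlgHom.ofLinearMap
    { toFun := fun a => tensor (Function.update 1 i a)
      map_add' := fun a b => by
        ext σ τ
        simp only [Matrix.add_apply, tensor_update_apply, add_mul]
      map_smul' := fun c a => by
        ext σ τ
        simp only [Matrix.smul_apply, tensor_update_apply, smul_eq_mul, RingHom.id_apply,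
          mul_assoc] }
    (by
      change tensor (Function.update 1 i 1) = 1
      rw [show Function.update (1 : Fin N → Matrix (Fin k) (Fin k) ℂ) i 1 = 1 from
        Function.update_eq_self i 1]
      exact tensor_one)
    (fun a b => by
      change tensor (Function.update 1 i (a * b)) = tensor (Function.update 1 i a) *
        tensor (Function.update 1 i b)
      rw [tensor_mul]
      congr 1
      funext j
      rcases eq_or_ne j i with rfl | hj
      · simp
      · simp [Function.update_of_ne hj])

lemma siteHom_apply (i : Fin N) (a : Matrix (Fin k) (Fin k) ℂ) :
    siteHom N i a = tensor (Function.update 1 i a) := rfl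

lemma star_siteHom (i : Fin N) (a : Matrix (Fin k) (Fin k) ℂ) :
    star (siteHom N i a) = siteHom N i (star a) := by
  rw [siteHom_apply, siteHom_apply, star_tensor]
  congr 1
  funext j
  rcases eq_or_ne j i with rfl | hj
  · simp
  · simp [Function.update_of_ne hj]

/-- Taking the same `a` on both sites makes the claim true also for `i = j`, so no distinctness
hypothesis is needed. -/
lemma commute_siteHom (i j : Fin N) (a : Matrix (Fin k) (Fin k) ℂ) :
    Commute (siteHom N i a) (siteHom N j a) := by
  rw [commute_iff_eq, siteHom_apply, siteHom_apply, tensor_mul, tensor_mul]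
  congr 1
  funext l
  rcases eq_or_ne l i with rfl | hi <;> rcases eq_or_ne l j with rfl | hj
  · rfl
  · simp [Function.update_of_ne hj]
  · simp [Function.update_of_ne hi]
  · simp [Function.update_of_ne hi, Function.update_of_ne hj]

/-- The summands commute, so the exponential of the sum is the product of exponentials, and each
factor is the exponential at a single site because `siteHom` is a continuous algebra homomorphism.
-/
lemma exp_sum_siteHom (a : Matrix (Fin k) (Fin k) ℂ) (s : Finset (Fin N)) :
    NormedSpace.exp (∑ i ∈ s, siteHom N i a)
      = tensor fun i => if i ∈ s then NormedSpace.exp a else 1 := by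
  induction s using Finset.induction_on with
  | empty => simpa using tensor_one.symm
  | insert i s hi ih =>
    let : NormedAlgebra ℚ (Matrix (Fin k) (Fin k) ℂ) := NormedAlgebra.restrictScalars ℚ ℂ _
    rw [Finset.sum_insert hi, Matrix.exp_add_of_commute _ _
      (Commute.sum_right _ _ _ fun j _ => commute_siteHom i j a), ih,
      ← NormedSpace.map_exp (siteHom N i) (siteHom N i).toLinearMap.continuous_of_finiteDimensional,
      siteHom_apply, tensor_mul]
    congr 1
    funext j
    rcases eq_or_ne j i with rfl | hj
    · simp [hi]
    · simp [hj]

lemma prodFun_sum_siteHom (ρ : SiteState k) (a : Matrix (Fin k) (Fin k) ℂ) :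
    prodFun ρ N (∑ i, siteHom N i a) = N * ρ a := by
  have h : ∀ i : Fin N, prodFun ρ N (siteHom N i a) = ρ a := fun i => by
    rw [siteHom_apply, prodFun_tensor, ← Finset.mul_prod_erase _ _ (Finset.mem_univ i),
      Function.update_self, Finset.prod_eq_one, mul_one]
    intro j hj
    rw [Function.update_of_ne (Finset.ne_of_mem_erase hj)]
    exact ρ.map_one'
  simp [h]

lemma isSelfAdjoint_sum_siteHom {a : Matrix (Fin k) (Fin k) ℂ} (ha : IsSelfAdjoint a) :
    IsSelfAdjoint (∑ i, siteHom N i a) := by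
  rw [IsSelfAdjoint, star_sum]
  exact Finset.sum_congr rfl fun i _ => by rw [star_siteHom, ha.star_eq]

lemma exp_sum_siteHom_log {T : Matrix (Fin k) (Fin k) ℂ} (hT : T.PosDef) :
    NormedSpace.exp (∑ i, siteHom N i (cfc Real.log T)) = tensor fun _ => T := by
  rw [exp_sum_siteHom]
  have : NormedSpace.exp (cfc Real.log T) = T :=
    CFC.exp_log T (Matrix.isStrictlyPositive_iff_posDef.2 hT)
  simp [this]

/-- The self-adjoint sum of one-site logarithms exponentiates to the tensor power, and the logarithm
inverts the exponential. This additivity is the source of extensivity of the entropy. -/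
lemma cfc_log_tensor {T : Matrix (Fin k) (Fin k) ℂ} (hT : T.PosDef) :
    cfc Real.log (tensor fun _ : Fin N => T) = ∑ i, siteHom N i (cfc Real.log T) := by
  rw [← exp_sum_siteHom_log hT]
  exact CFC.log_exp _ (isSelfAdjoint_sum_siteHom (cfc_predicate Real.log T))

/-- The tensor power is the exponential of a self-adjoint matrix, hence positive and invertible. -/
lemma posDef_tensor {T : Matrix (Fin k) (Fin k) ℂ} (hT : T.PosDef) :
    (tensor fun _ : Fin N => T).PosDef := by
  rw [← Matrix.isStrictlyPositive_iff_posDef, ← exp_sum_siteHom_log hT]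
  have h := isSelfAdjoint_sum_siteHom (N := N) (cfc_predicate Real.log T)
  exact IsStrictlyPositive.iff_of_unital.2 ⟨h.exp_nonneg, Matrix.isUnit_exp _⟩

lemma density_prodFun (ρ : SiteState k) :
    density (prodFun ρ N) = tensor fun _ => density ρ.toLin := by
  ext σ τ
  change prodFun ρ N (Matrix.single τ σ 1) = ∏ i, ρ (Matrix.single (τ i) (σ i) 1)
  rw [single_eq_tensor, one_smul, prodFun_tensor]

lemma continuous_prodState : Continuous fun ρ : SiteState k => prodState ρ N :=
  State.continuous_of_eval fun A => (prodEval k N A).continuous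

/-- The entropy of product states is extensive. -/
lemma entropy_prodFun [NeZero k] (ρ : SiteState k) :
    entropy (prodFun ρ N) = N * entropy ρ.toLin := by
  -- Additivity of the logarithm needs positive definite densities, so the formula is proved for
  -- faithful approximations and extended by continuity of both sides.
  have h : ∀ m, entropy (prodFun (depolarize m ρ) N) = N * entropy (depolarize m ρ).toLin := by
    intro m
    rw [entropy_eq_neg_re_apply_log, entropy_eq_neg_re_apply_log, density_prodFun,
      cfc_log_tensor (posDef_density_depolarize m ρ), prodFun_sum_siteHom,
      ← Complex.ofReal_natCast, Complex.re_ofReal_mul, mul_neg]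
  have h1 := ((continuous_entropy.comp (continuous_prodState (N := N))).tendsto ρ).comp
    (tendsto_depolarize ρ)
  have h2 := (((continuous_entropy.tendsto ρ).comp (tendsto_depolarize ρ)).const_mul (N : ℝ))
  exact tendsto_nhds_unique (h1.congr h) h2

end TensorLog

/-! ### Mean entropy -/

/-- The restriction to `N` sites of a mixture of product states. -/
def marginal {k : ℕ} (φ : State C(SiteState k, ℂ)) (N : ℕ) : State (SpinAlg k N) where
  toLin := φ.toLin ∘ₗ prodEval k N
  nonneg' A := φ.apply_nonneg (prodEval_nonneg A)
  map_one' := by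
    rw [LinearMap.comp_apply, prodEval_one, φ.map_one']

lemma marginal_apply {k : ℕ} (φ : State C(SiteState k, ℂ)) (N : ℕ) (A : SpinAlg k N) :
    marginal φ N A = φ (prodEval k N A) := rfl

/-- The one-site entropy as a continuous function. -/
def siteEntropy (k : ℕ) : C(SiteState k, ℂ) :=
  ⟨fun ρ => (entropy ρ.toLin : ℂ), Complex.continuous_ofReal.comp continuous_entropy⟩

lemma siteEntropy_apply {k : ℕ} (ρ : SiteState k) : siteEntropy k ρ = (entropy ρ.toLin : ℂ) := rfl

section MeanEntropy

variable {k : ℕ} [NeZero k]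

/-- Lower bound for the entropy: concavity. -/
lemma mul_apply_siteEntropy_le (φ : State C(SiteState k, ℂ)) (N : ℕ) :
    N * (φ (siteEntropy k)).re ≤ entropy (marginal φ N).toLin := by
  -- Let σ be a depolarization of the marginal. Klein's inequality for each product state gives N
  -- s₀(ρ) ≤ -ρ^{⊗N}(log σ). Applying φ turns the right side into minus the marginal of log σ, which
  -- is at most S(σ)/w; this tends to the entropy of the marginal.
  refine ge_of_tendsto' (tendsto_entropy_depolarize_div (marginal φ N)) fun m =>
    le_trans ?_ (neg_re_apply_log_depolarize_le m (marginal φ N))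
  rw [marginal_apply, ← Complex.neg_re, ← map_neg, ← Complex.re_ofReal_mul, ← smul_eq_mul,
    ← map_smul]
  refine φ.re_apply_le_re_apply fun ρ => ?_
  have h := entropy_le_of_posDef (prodState ρ N) (posDef_density_depolarize m (marginal φ N))
    (State.trace_density _)
  have h2 : entropy (prodState ρ N).toLin = N * entropy ρ.toLin := entropy_prodFun ρ
  rw [h2] at h
  simpa [siteEntropy_apply] using! h

/-- Finitely many faithful states suffice to approximate the entropy by relative entropies. -/
lemma exists_finset_faithful (k : ℕ) [NeZero k] {ε : ℝ} (hε : 0 < ε) :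
    ∃ t : Finset (SiteState k), (∀ σ ∈ t, (density σ.toLin).PosDef) ∧
      ∀ ρ : SiteState k, ∃ σ ∈ t,
        -(ρ (cfc Real.log (density σ.toLin))).re < entropy ρ.toLin + ε := by
  classical
  have h : ∀ ρ : SiteState k, ∃ σ : SiteState k, (density σ.toLin).PosDef ∧
      -(ρ (cfc Real.log (density σ.toLin))).re < entropy ρ.toLin + ε := fun ρ => by
    obtain ⟨m, hm⟩ := ((tendsto_entropy_depolarize_div ρ).eventually_lt_const
      (lt_add_of_pos_right _ hε)).exists
    exact ⟨depolarize m ρ, posDef_density_depolarize m ρ,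
      (neg_re_apply_log_depolarize_le m ρ).trans_lt hm⟩
  choose σ hσ hlt using h
  -- For fixed faithful σ both sides are continuous in ρ, so one σ works on a neighbourhood, and
  -- compactness leaves finitely many.
  obtain ⟨t, ht⟩ := CompactSpace.elim_nhds_subcover
    (fun ρ' => {ρ | -(ρ (cfc Real.log (density (σ ρ').toLin))).re < entropy ρ.toLin + ε})
    fun ρ' => (isOpen_lt (Complex.continuous_re.comp (State.continuous_eval _)).neg
      (continuous_entropy.add continuous_const)).mem_nhds (hlt ρ')
  refine ⟨t.image σ, fun τ hτ => ?_, fun ρ => ?_⟩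
  · obtain ⟨ρ, -, rfl⟩ := Finset.mem_image.1 hτ
    exact hσ ρ
  · have : ρ ∈ ⋃ x ∈ t, {ρ | -(ρ (cfc Real.log (density (σ x).toLin))).re < entropy ρ.toLin + ε} :=
      ht ▸ Set.mem_univ ρ
    simp only [Set.mem_iUnion] at this
    obtain ⟨x, hx, h⟩ := this
    exact ⟨σ x, Finset.mem_image_of_mem σ hx, h⟩

/-- Upper bound for the entropy. -/
lemma exists_entropy_marginal_le (k : ℕ) [NeZero k] {ε : ℝ} (hε : 0 < ε) :
    ∃ C : ℝ, ∀ (φ : State C(SiteState k, ℂ)) (N : ℕ),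
      entropy (marginal φ N).toLin ≤ C + N * ((φ (siteEntropy k)).re + ε) := by
  obtain ⟨t, ht, hcov⟩ := exists_finset_faithful k hε
  have hne : t.Nonempty := by
    obtain ⟨σ, hσ, -⟩ := hcov (tracialState (Fin k))
    exact ⟨σ, hσ⟩
  have hcard : (0 : ℝ) < t.card := by exact_mod_cast hne.card_pos
  refine ⟨Real.log t.card, fun φ N => ?_⟩
  -- One comparison density for all mixtures: the uniform average of the tensor powers over the
  -- finite set. It dominates each of them up to the factor 1/|t|, whose logarithm is a constant
  -- independent of `N` and `φ`.
  let T : SpinAlg k N := ((t.card : ℝ))⁻¹ • ∑ σ ∈ t, tensor fun _ => density σ.toLin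
  have hle : ∀ σ ∈ t, ((t.card : ℝ))⁻¹ • (tensor fun _ => density σ.toLin) ≤ T := fun σ hσ => by
    refine smul_le_smul_of_nonneg_left ?_ (by positivity)
    refine Finset.single_le_sum (f := fun σ : SiteState k =>
      (tensor fun _ => density σ.toLin : SpinAlg k N)) (fun τ hτ => ?_) hσ
    exact Matrix.nonneg_iff_posSemidef.2 (posDef_tensor (ht τ hτ)).posSemidef
  have hpos : ∀ σ ∈ t, IsStrictlyPositive (tensor fun _ => density σ.toLin : SpinAlg k N) :=
    fun σ hσ => Matrix.isStrictlyPositive_iff_posDef.2 (posDef_tensor (ht σ hσ))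
  have hpos' : ∀ σ ∈ t, IsStrictlyPositive
      (((t.card : ℝ))⁻¹ • (tensor fun _ => density σ.toLin : SpinAlg k N)) :=
    fun σ hσ => (hpos σ hσ).smul (inv_pos.2 hcard)
  have hT : T.PosDef := by
    obtain ⟨σ, hσ⟩ := hne
    exact Matrix.isStrictlyPositive_iff_posDef.1 ((hpos' σ hσ).of_le (hle σ hσ))
  have hT1 : T.trace = 1 := by
    have h1 : ∀ σ : SiteState k, (tensor fun _ : Fin N => density σ.toLin).trace = 1 := fun σ => by
      rw [← density_prodFun]; exact (prodState σ N).trace_density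
    rw [Matrix.trace_smul, Matrix.trace_sum, Finset.sum_congr rfl fun σ _ => h1 σ]
    simp only [Finset.sum_const, nsmul_eq_mul, mul_one, Complex.real_smul]
    push_cast
    exact inv_mul_cancel₀ (by exact_mod_cast hcard.ne')
  -- Operator monotonicity of the logarithm gives -log T ≤ log |t| - ∑ᵢ log σᵢ, where σᵢ is the
  -- density of σ at site i. Evaluated in ρ^{⊗N}, with σ chosen near-optimal for ρ, each site costs
  -- at most s₀(ρ) + ε.
  have hlog : ∀ ρ : SiteState k, -(prodFun ρ N (cfc Real.log T)).re
      ≤ Real.log t.card + N * (entropy ρ.toLin + ε) := fun ρ => by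
    obtain ⟨σ, hσ, h⟩ := hcov ρ
    have h1 : CFC.log (((t.card : ℝ))⁻¹ • (tensor fun _ => density σ.toLin : SpinAlg k N))
        ≤ CFC.log T := CFC.log_le_log (hle σ hσ) (hpos' σ hσ)
    rw [CFC.log_smul' _ (inv_pos.2 hcard) (hpos σ hσ), Real.log_inv,
      Algebra.algebraMap_eq_smul_one, CFC.log, cfc_log_tensor (ht σ hσ)] at h1
    have h2 := (prodState ρ N).re_apply_le h1
    rw [map_add, ← Complex.coe_smul, map_smul, (prodState ρ N).map_one'] at h2
    change (_ + prodFun ρ N _ : ℂ).re ≤ (prodFun ρ N (cfc Real.log T)).re at h2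
    rw [prodFun_sum_siteHom, Complex.add_re, ← Complex.ofReal_natCast, Complex.re_ofReal_mul] at h2
    have h3 := mul_le_mul_of_nonneg_left h.le (Nat.cast_nonneg (α := ℝ) N)
    rw [smul_eq_mul, mul_one, Complex.ofReal_re] at h2
    linarith
  refine (entropy_le_of_posDef (marginal φ N) hT hT1).trans ?_
  generalize Real.log t.card = L at hlog ⊢
  have h := φ.re_apply_le_re_apply (f := -prodEval k N (cfc Real.log T))
    (g := ((L + N * ε : ℝ) : ℂ) • 1 + ((N : ℝ) : ℂ) • siteEntropy k) fun ρ => by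
      have := hlog ρ
      simp [siteEntropy_apply]
      linarith
  rw [map_neg, map_add, map_smul, map_smul, φ.map_one', smul_eq_mul, smul_eq_mul, mul_one,
    Complex.add_re, Complex.ofReal_re, Complex.re_ofReal_mul, Complex.neg_re] at h
  refine h.trans_eq ?_
  ring

/-- The mean entropy of a mixture of product states. -/
lemma tendsto_mean_entropy (φ : State C(SiteState k, ℂ)) :
    Tendsto (fun N : ℕ => (1 / (N : ℝ)) * entropy (marginal φ N).toLin) atTop
      (𝓝 (φ (siteEntropy k)).re) := by
  rw [Metric.tendsto_atTop]
  intro ε hε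
  obtain ⟨C, hC⟩ := exists_entropy_marginal_le k (half_pos hε)
  -- Beyond `N₀` the constant contributes less than ε/2 per site; the extra 1 makes `N` positive.
  obtain ⟨N₀, hN₀⟩ := exists_nat_gt (C / (ε / 2))
  refine ⟨N₀ + 1, fun N hN => ?_⟩
  have hN0 : (0 : ℝ) < N := by exact_mod_cast (Nat.succ_pos _).trans_le hN
  have hN1 : (N₀ : ℝ) < N := by exact_mod_cast hN
  have h1 := mul_apply_siteEntropy_le φ N
  have h2 := hC φ N
  have h3 : C < N * (ε / 2) := (div_lt_iff₀ (half_pos hε)).1 (hN₀.trans hN1)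
  rw [Real.dist_eq, one_div, abs_lt]
  constructor
  · have : (φ (siteEntropy k)).re ≤ (N : ℝ)⁻¹ * entropy (marginal φ N).toLin := by
      rwa [le_inv_mul_iff₀ hN0]
    linarith
  · rw [sub_lt_iff_lt_add, inv_mul_lt_iff₀ hN0]
    linarith

end MeanEntropy

/-! ### Thermodynamic limits -/

lemma restrict_eq_marginal {k : ℕ} (ω : PermInvState k) (N : ℕ) :
    restrict ω.1 N = (marginal (permInvHomeo k ω) N).toLin := by
  rw [← mixture_permInvHomeo ω, restrict_mixture]; rfl

/-- The symbols of a quasi-symmetric sequence converge uniformly. -/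
lemma IsQuasiSymmetricSeq.exists_tendsto_prodEval {k : ℕ} {H : ∀ N, SpinAlg k N}
    (hH : IsQuasiSymmetricSeq H) :
    ∃ h₀ : C(SiteState k, ℂ), Tendsto (fun N => prodEval k N (H N)) atTop (𝓝 h₀) := by
  refine cauchySeq_tendsto_of_complete (Metric.cauchySeq_iff'.2 fun ε hε => ?_)
  obtain ⟨H', ⟨M, A, hA⟩, M₀, hM₀⟩ := hH.2 (ε / 2) (half_pos hε)
  have near : ∀ N, max M (M₀ + 1) ≤ N → dist (prodEval k N (H N)) (prodEval k M A) < ε / 2 := by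
    intro N hN
    have hMN : M ≤ N := (le_max_left _ _).trans hN
    -- The symbol of a symmetric sequence is independent of `N` from `M` on, so it is a fixed
    -- function approximating all later symbols.
    have h1 : prodEval k M A = prodEval k N (H' N) := by
      rw [hA N hMN, symmEmbed, prodEval_symmetrizer, prodEval_embed]
    rw [h1, dist_eq_norm, ← map_sub]
    exact (norm_prodEval_le _).trans_lt (hM₀ N ((le_max_right _ _).trans hN))
  refine ⟨max M (M₀ + 1), fun N hN => ?_⟩
  have h1 := near N hN
  have h2 := near _ le_rfl
  rw [dist_comm] at h2
  exact (dist_triangle _ _ _).trans_lt ((add_lt_add h1 h2).trans_eq (add_halves ε))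

/-- The inverse map `mixture` is affine and injective, so convex combinations can be compared after
applying it. -/
lemma isConvexComb_permInvHomeo {k : ℕ} {t : ℝ} {ω₁ ω₂ ω : PermInvState k}
    (h : State.IsConvexComb t ω₁.1 ω₂.1 ω.1) :
    State.IsConvexComb t (permInvHomeo k ω₁) (permInvHomeo k ω₂) (permInvHomeo k ω) := by
  refine ⟨h.1, h.2.1, ?_⟩
  have e : permInvHomeo k ω
      = State.mix t h.1 h.2.1 (permInvHomeo k ω₁) (permInvHomeo k ω₂) := by
    refine mixture_injective (State.ext_apply fun a => ?_)
    rw [mixture_permInvHomeo, h.apply, mixture_apply, State.mix_apply, ← mixture_apply,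
      ← mixture_apply, mixture_permInvHomeo, mixture_permInvHomeo]
  rw [e]; rfl

lemma exists_unique_deFinettiMeasure {k : ℕ} (ω : PermInvState k) :
    ∃ μ : ProbabilityMeasure (SiteState k), IsDeFinettiMeasure ω.1 μ ∧
      (∀ ν : ProbabilityMeasure (SiteState k), IsDeFinettiMeasure ω.1 ν → ν = μ) ∧
      ∀ f : C(SiteState k, ℂ), permInvHomeo k ω f = ∫ ρ, f ρ ∂(μ : Measure (SiteState k)) := by
  obtain ⟨μ, hμ⟩ := integralState_surjective (permInvHomeo k ω)
  refine ⟨μ, (isDeFinettiMeasure_iff _ _).2 (by rw [hμ, mixture_permInvHomeo]), fun ν hν => ?_,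
    fun f => by rw [← hμ, integralState_apply]⟩
  refine integralState_injective (mixture_injective ?_)
  rw [(isDeFinettiMeasure_iff _ _).1 hν, hμ, mixture_permInvHomeo]

lemma apply_siteEntropy_eq {k : ℕ} (φ : State C(SiteState k, ℂ)) :
    ((φ (siteEntropy k)).re : ℂ) = φ (siteEntropy k) :=
  Complex.ext rfl (φ.apply_im_eq_zero fun _ => Complex.ofReal_im _).symm

end MeanField

end

/-! ### Assembly of the thermodynamic limits -/

open MeanField in
theorem proposition4p2 (k : ℕ) (hk : 1 ≤ k) :
    ∃ (Φ : PermInvState k ≃ₜ State C(SiteState k, ℂ)) (s₀ : C(SiteState k, ℂ))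
      (S : State C(SiteState k, ℂ) → ℝ),
      -- the identification of permutation-invariant states with states on `C(S(M_k(ℂ)))`
      -- is affine and given by integration against the unique de Finetti measure
      (∀ (t : ℝ) (ω₁ ω₂ ω : PermInvState k), State.IsConvexComb t ω₁.1 ω₂.1 ω.1 →
        State.IsConvexComb t (Φ ω₁) (Φ ω₂) (Φ ω)) ∧
      (∀ ω : PermInvState k, ∃ μ : ProbabilityMeasure (SiteState k),
        IsDeFinettiMeasure ω.1 μ ∧
        (∀ ν : ProbabilityMeasure (SiteState k), IsDeFinettiMeasure ω.1 ν → ν = μ) ∧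
        ∀ f : C(SiteState k, ℂ), Φ ω f = ∫ ρ, f ρ ∂(μ : Measure (SiteState k))) ∧
      -- entropy density
      (∀ ρ : SiteState k, s₀ ρ = (entropy ρ.toLin : ℂ)) ∧
      (∀ ω : PermInvState k,
        Tendsto (fun N : ℕ => (1 / (N : ℝ)) * entropy (restrict ω.1 N)) atTop (𝓝 (S (Φ ω)))) ∧
      (∀ φ, (S φ : ℂ) = φ s₀) ∧ Continuous S ∧ State.IsAffine S ∧
      -- internal energy density and free energy density
      ∀ H : ∀ N, SpinAlg k N, IsQuasiSymmetricSeq H →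
        ∃ (h₀ : C(SiteState k, ℂ)) (U : State C(SiteState k, ℂ) → ℂ)
          (F : ℝ → State C(SiteState k, ℂ) → ℂ),
          (∀ ρ : SiteState k, Tendsto (fun N => prodState ρ N (H N)) atTop (𝓝 (h₀ ρ))) ∧
          (∀ ω : PermInvState k,
            Tendsto (fun N : ℕ => (1 / (N : ℂ)) *
              localEnergy (hamiltonian H N) (restrict ω.1 N)) atTop (𝓝 (U (Φ ω)))) ∧
          (∀ φ, U φ = φ h₀) ∧ Continuous U ∧ State.IsAffine U ∧
          ∀ β : ℝ, 0 < β →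
            (∀ ω : PermInvState k,
              Tendsto (fun N : ℕ => (1 / (N : ℂ)) *
                localFreeEnergy β (hamiltonian H N) (restrict ω.1 N)) atTop
                (𝓝 (F β (Φ ω)))) ∧
            (∀ φ, F β φ = φ h₀ - (β : ℂ)⁻¹ * φ s₀) ∧ Continuous (F β) ∧
            State.IsAffine (F β) := by
  -- A nonempty basis is needed for the normalised trace used in the faithful approximations.
  have : NeZero k := ⟨by omega⟩
  have hS : ∀ ω : PermInvState k, Tendsto (fun N : ℕ => (1 / (N : ℝ)) * entropy (restrict ω.1 N))
      atTop (𝓝 (permInvHomeo k ω (siteEntropy k)).re) := fun ω => by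
    simp only [restrict_eq_marginal]
    exact tendsto_mean_entropy _
  refine ⟨permInvHomeo k, siteEntropy k, fun φ => (φ (siteEntropy k)).re,
    fun t ω₁ ω₂ ω h => isConvexComb_permInvHomeo h, exists_unique_deFinettiMeasure,
    siteEntropy_apply, hS, apply_siteEntropy_eq,
    Complex.continuous_re.comp (State.continuous_eval _), fun t φ₁ φ₂ φ h => ?_, fun H hH => ?_⟩
  · beta_reduce
    rw [h.apply, Complex.add_re, Complex.re_ofReal_mul, Complex.re_ofReal_mul]; rfl
  obtain ⟨h₀, hh₀⟩ := hH.exists_tendsto_prodEval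
  have hU : ∀ ω : PermInvState k, Tendsto (fun N : ℕ => (1 / (N : ℂ)) *
      localEnergy (hamiltonian H N) (restrict ω.1 N)) atTop (𝓝 (permInvHomeo k ω h₀)) := fun ω => by
    -- The factors `N` and `1 / N` cancel for `N > 0`, leaving the state of C(X) applied to the
    -- uniformly convergent symbols.
    refine (((permInvHomeo k ω).continuous_coe.tendsto h₀).comp hh₀).congr' ?_
    filter_upwards [eventually_gt_atTop 0] with N hN
    have hN' : (N : ℂ) ≠ 0 := by exact_mod_cast hN.ne'
    rw [restrict_eq_marginal, localEnergy, hamiltonian, map_smul, smul_eq_mul, one_div,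
      inv_mul_cancel_left₀ hN']
    rfl
  have hF : ∀ β : ℝ, Continuous fun φ : State C(SiteState k, ℂ) =>
      φ h₀ - (β : ℂ)⁻¹ * φ (siteEntropy k) := fun β =>
    (State.continuous_eval _).sub (continuous_const.mul (State.continuous_eval _))
  refine ⟨h₀, fun φ => φ h₀, fun β φ => φ h₀ - (β : ℂ)⁻¹ * φ (siteEntropy k), fun ρ => ?_, hU,
    fun _ => rfl, State.continuous_eval _, State.isAffine_eval _, fun β _ =>
      ⟨fun ω => ?_, fun _ => rfl, hF β, fun t φ₁ φ₂ φ h => ?_⟩⟩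
  -- The pointwise limit is the energy argument for the Dirac state at ρ.
  · exact ((State.dirac ρ).continuous_coe.tendsto h₀).comp hh₀
  · have hS' := (Complex.continuous_ofReal.tendsto _).comp (hS ω)
    rw [apply_siteEntropy_eq] at hS'
    refine ((hU ω).sub (hS'.const_mul (β : ℂ)⁻¹)).congr fun N => ?_
    simp only [Function.comp_apply, localFreeEnergy]
    push_cast
    ring
  · beta_reduce
    rw [h.apply, h.apply, Complex.real_smul, Complex.real_smul]
    ring
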